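/- Let $(\mathcal A,\mathcal E)$ be an exact category in the sense of Quillen: $\mathcal A$ is an additive category and $\mathcal E$ is a class of kernel–cokernel pairs $a'\to a\to a''$ (the admissible short exact sequences, whose first and second maps are called admissible monomorphisms and admissible epimorphisms), closed under isomorphism, containing the split sequences $a'\to a'\oplus a''\to a''$, such that admissible epimorphisms have pullbacks along arbitrary maps and these are again admissible epimorphisms, dually for admissible monomorphisms and pushouts, and such that a map $f$ that has a kernel and for which some composite $f\circ g$ is an admissible epimorphism is itself an admissible epimorphism, and dually. *The Beilinson category.* Let $\Pi=\{(i,j)\in\mathbb Z\times\mathbb Z : i\le j\}$ with the product order. A functor $X\colon\Pi\to\mathcal A$ is admissible if for all $i\le j\le k$ the sequence $X_{i,j}\to X_{i,k}\to X_{j,k}$ is in $\mathcal E$. Call $\varphi\colon\mathbb Z\to\mathbb Z$ bicofinal if it is nondecreasing with $\lim_{n\to\pm\infty}\varphi(n)=\pm\infty$, and put $\tilde\varphi(i,j)=(\varphi(i),\varphi(j))$. The category $\underleftrightarrow{\lim}\,\mathcal A$ is the localization of the category of admissible functors $\Pi\to\mathcal A$ and natural transformations at the class of all canonical maps $X\circ\tilde\varphi_0\to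 X\circ\tilde\varphi_1$ with $X$ admissible and $\varphi_0\le\varphi_1$ bicofinal. *The admissible Kato category.* Let $\mathrm{IP}^a(\mathcal A)$ be the full subcategory of $\mathrm{Ind}(\mathrm{Pro}(\mathcal A))$ of the objects isomorphic to a formal limit $``\varinjlim_{j\in J}"\,``\varprojlim_{i\in I}"\,X_{i,j}$ of a bifunctor $X\colon I^{op}\times J\to\mathcal A$, where $I,J$ are countable filtering preorders, $X_{i',j}\to X_{i,j}$ is an admissible epimorphism for all $i\le i'$ and $j$, and $X_{i,j}\to X_{i,j'}$ is an admissible monomorphism for all $i$ and $j\le j'$. Let $\kappa^a(\mathcal A)$ be the full subcategory of $\mathrm{IP}^a(\mathcal A)$ of the objects that have such a presentation in which moreover, for all $i\le i'$ and $j\le j'$, the square with vertices $X_{i',j},X_{i',j'},X_{i,j},X_{i,j'}$ is cartesian. **Theorem.** The assignment $X\mapsto ``\varinjlim_{j}"\,``\varprojlim_{i\le j}"\,X_{i,j}$ (with $i\to-\infty$, $j\to+\infty$) takes admissible functors $\Pi\to\mathcal A$ to objects of $\kappa^a(\mathcal A)$ and induces a functor $$ i\colon\ \underleftrightarrow{\lim}\,\mathcal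 A\longrightarrow\kappa^a(\mathcal A), $$ and this functor is an equivalence of categories. -/

import Mathlib

open CategoryTheory CategoryTheory.Limits Opposite

universe v u

noncomputable section

namespace LocCompact

/-! ### Exact categories -/

section Exact

variable {A : Type u} [Category.{v} A] [Preadditive A]

/-- `f` is the first map of a member of the class `E` of short sequences. -/
def IsAdmMono (E : ShortComplex A → Prop) {a b : A} (f : a ⟶ b) : Prop :=
  ∃ (c : A) (g : b ⟶ c) (w : f ≫ g = 0), E (ShortComplex.mk f g w)

/-- `g` is the second map of a member of the class `E` of short sequences. -/
def IsAdmEpi (E : ShortComplex A → Prop) {b c : A} (g : b ⟶ c) : Prop :=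
  ∃ (a : A) (f : a ⟶ b) (w : f ≫ g = 0), E (ShortComplex.mk f g w)

variable (A) in
/-- A Quillen exact structure on an additive category `A`: a class `E` of short exact sequences
`0 ⟶ a' ⟶ a ⟶ a'' ⟶ 0`, that is, of kernel-cokernel pairs, satisfying the axioms below.
(Closure of admissible monomorphisms and of admissible epimorphisms under composition, which is
often added to the list, is not asked for.) -/
structure ExactStructure [HasZeroObject A] [HasBinaryBiproducts A] where
  /-- the admissible short exact sequences -/
  E : ShortComplex A → Prop
  isKernel : ∀ S, E S → Nonempty (IsLimit (KernelFork.ofι S.f S.zero))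
  isCokernel : ∀ S, E S → Nonempty (IsColimit (CokernelCofork.ofπ S.g S.zero))
  of_iso : ∀ S T : ShortComplex A, (S ≅ T) → E S → E T
  split : ∀ a b : A, E (ShortComplex.mk (biprod.inl : a ⟶ a ⊞ b) biprod.snd biprod.inl_snd)
  exists_pullback : ∀ {a' a'' b'' : A} (j : a' ⟶ a'') (f : b'' ⟶ a''), IsAdmEpi E j →
    ∃ (b' : A) (j' : b' ⟶ b'') (f' : b' ⟶ a'), IsPullback j' f' f j ∧ IsAdmEpi E j'
  exists_pushout : ∀ {a a' b : A} (i : a ⟶ a') (f : a ⟶ b), IsAdmMono E i →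
    ∃ (b' : A) (i' : b ⟶ b') (f' : a' ⟶ b'), IsPushout f i i' f' ∧ IsAdmMono E i'
  admEpi_of_comp : ∀ {a b c : A} (g : a ⟶ b) (f : b ⟶ c), HasKernel f →
    IsAdmEpi E (g ≫ f) → IsAdmEpi E f
  admMono_of_comp : ∀ {a b c : A} (f : a ⟶ b) (g : b ⟶ c), HasCokernel f →
    IsAdmMono E (f ≫ g) → IsAdmMono E f

end Exact

/-! ### Ind-objects and pro-objects -/

section IndPro

variable {C : Type u} [Category.{v} C]

variable (C) in
/-- The category of pro-objects of `C`. -/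
abbrev Pro : Type (max u (v + 1)) := (Ind Cᵒᵖ)ᵒᵖ

instance hasColimitsOfShape_ind (J : Type) [SmallCategory J] [IsFiltered J] :
    HasColimitsOfShape J (Ind C) :=
  have : HasFilteredColimitsOfSize.{0, 0} (Ind C) :=
    hasFilteredColimitsOfSize_of_univLE.{0, 0, v, v}
  HasFilteredColimitsOfSize.HasColimitsOfShape J

instance hasLimitsOfShape_pro (I : Type) [SmallCategory I] [IsFiltered I] :
    HasLimitsOfShape Iᵒᵖ (Pro C) :=
  hasLimitsOfShape_op_of_hasColimitsOfShape

/-- The ind-object `"colim" X_j` of an ind-system `X : J ⥤ C`. -/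
def indLim (J : Type) [SmallCategory J] [IsFiltered J] : (J ⥤ C) ⥤ Ind C :=
  (Functor.whiskeringRight _ _ _).obj Ind.yoneda ⋙ colim

/-- The pro-object `"lim" X_i` of a pro-system `X : Iᵒᵖ ⥤ C`. -/
def proLim (I : Type) [SmallCategory I] [IsFiltered I] : (Iᵒᵖ ⥤ C) ⥤ Pro C :=
  (Functor.whiskeringRight _ _ _).obj (Ind.yoneda (C := Cᵒᵖ)).rightOp ⋙ lim

/-- The ind/pro-object `"colim"_j "lim"_i X_{i,j}` of a bifunctor `X`, contravariant in `i : I` and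
covariant in `j : J`. -/
def indProLim (I J : Type) [SmallCategory I] [IsFiltered I] [SmallCategory J] [IsFiltered J] :
    (J ⥤ Iᵒᵖ ⥤ C) ⥤ Ind (Pro C) :=
  (Functor.whiskeringRight _ _ _).obj (proLim I) ⋙ indLim J

end IndPro

/-! ### The admissible Kato category -/

section Kato

variable {A : Type u} [Category.{v} A] [Preadditive A] [HasZeroObject A]
  [HasBinaryBiproducts A]

/-- For `i ≤ i'` the map `X_{i',j} ⟶ X_{i,j}` is an admissible epimorphism, and for `j ≤ j'` the map
`X_{i,j} ⟶ X_{i,j'}` is an admissible monomorphism. -/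
structure IsAdmBifunctor (𝓔 : ExactStructure A) {I J : Type} [SmallCategory I] [SmallCategory J]
    (X : J ⥤ Iᵒᵖ ⥤ A) : Prop where
  admEpi : ∀ (j : J) {i i' : I} (f : i ⟶ i'), IsAdmEpi 𝓔.E ((X.obj j).map f.op)
  admMono : ∀ (i : I) {j j' : J} (g : j ⟶ j'), IsAdmMono 𝓔.E ((X.map g).app (op i))

/-- All the squares with vertices `X_{i',j}`, `X_{i',j'}`, `X_{i,j}`, `X_{i,j'}` are cartesian. -/
def HasCartesianSquares {I J : Type} [SmallCategory I] [SmallCategory J]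
    (X : J ⥤ Iᵒᵖ ⥤ A) : Prop :=
  ∀ {i i' : I} (f : i ⟶ i') {j j' : J} (g : j ⟶ j'),
    IsPullback ((X.map g).app (op i')) ((X.obj j).map f.op) ((X.obj j').map f.op)
      ((X.map g).app (op i))

/-- The strictly admissible straightified ind/pro-objects of countable type: the formal limits of
admissible bifunctors indexed by countable filtering preorders. -/
def isIPa (𝓔 : ExactStructure A) : ObjectProperty (Ind (Pro A)) := fun P =>
  ∃ (I J : Type) (_ : Preorder I) (_ : Preorder J) (_ : Countable I) (_ : Countable J)
    (_ : IsFiltered I) (_ : IsFiltered J) (X : J ⥤ Iᵒᵖ ⥤ A),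
    IsAdmBifunctor 𝓔 X ∧ Nonempty (P ≅ (indProLim I J).obj X)

/-- Those formal limits of admissible bifunctors whose squares are cartesian. -/
def isKato (𝓔 : ExactStructure A) : ObjectProperty (Ind (Pro A)) := fun P =>
  ∃ (I J : Type) (_ : Preorder I) (_ : Preorder J) (_ : Countable I) (_ : Countable J)
    (_ : IsFiltered I) (_ : IsFiltered J) (X : J ⥤ Iᵒᵖ ⥤ A),
    IsAdmBifunctor 𝓔 X ∧ HasCartesianSquares X ∧ Nonempty (P ≅ (indProLim I J).obj X)

theorem isKato_le_isIPa (𝓔 : ExactStructure A) : isKato 𝓔 ≤ isIPa 𝓔 := by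
  rintro P ⟨I, J, _, _, hI, hJ, _, _, X, hX, _, e⟩
  exact ⟨I, J, _, _, hI, hJ, _, _, X, hX, e⟩

/-- The category `IPᵃ(A)`. -/
abbrev IPa (𝓔 : ExactStructure A) := (isIPa 𝓔).FullSubcategory

/-- The admissible Kato category `κᵃ(A)`, a full subcategory of `IPᵃ(A)`. -/
abbrev Kato (𝓔 : ExactStructure A) := ((isKato 𝓔).inverseImage (isIPa 𝓔).ι).FullSubcategory

end Kato

/-! ### The Beilinson category -/

section Beilinson

/-- The preorder of the pairs of integers `(i, j)` with `i ≤ j`. -/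
abbrev Wedge : Type := {p : ℤ × ℤ // p.1 ≤ p.2}

/-- The pair `(i, j)`. -/
abbrev Wedge.mk (i j : ℤ) (h : i ≤ j) : Wedge := ⟨(i, j), h⟩

/-- The arrow `(i, j) ⟶ (i', j')` of `Wedge`. -/
abbrev Wedge.hom {i j i' j' : ℤ} (h : i ≤ j) (h' : i' ≤ j') (hi : i ≤ i') (hj : j ≤ j') :
    Wedge.mk i j h ⟶ Wedge.mk i' j' h' :=
  homOfLE (show Wedge.mk i j h ≤ Wedge.mk i' j' h' from ⟨hi, hj⟩)

/-- A bicofinal map: nondecreasing, with limit `±∞` at `±∞`. -/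
structure Bicofinal where
  /-- the underlying map -/
  toFun : ℤ → ℤ
  mono : Monotone toFun
  tendsto_atTop : Filter.Tendsto toFun Filter.atTop Filter.atTop
  tendsto_atBot : Filter.Tendsto toFun Filter.atBot Filter.atBot

/-- The endofunctor `(i, j) ↦ (φ i, φ j)` of `Wedge`. -/
def Bicofinal.tilde (φ : Bicofinal) : Wedge ⥤ Wedge :=
  Monotone.functor (f := fun p : Wedge => Wedge.mk (φ.toFun p.1.1) (φ.toFun p.1.2) (φ.mono p.2))
    (fun _ _ h => ⟨φ.mono h.1, φ.mono h.2⟩)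

/-- The transformation between the endofunctors of `Wedge` attached to `φ₀ ≤ φ₁`. -/
def Bicofinal.tildeHom {φ₀ φ₁ : Bicofinal} (h : ∀ n, φ₀.toFun n ≤ φ₁.toFun n) :
    φ₀.tilde ⟶ φ₁.tilde where
  app p := Wedge.hom (φ₀.mono p.2) (φ₁.mono p.2) (h p.1.1) (h p.1.2)
  naturality _ _ _ := Subsingleton.elim _ _

variable {A : Type u} [Category.{v} A] [Preadditive A] [HasZeroObject A]
  [HasBinaryBiproducts A]

/-- `X : Wedge ⥤ A` is admissible if `X_{i,j} ⟶ X_{i,k} ⟶ X_{j,k}` is an admissible short exact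
sequence whenever `i ≤ j ≤ k`. -/
def isAdm (𝓔 : ExactStructure A) : ObjectProperty (Wedge ⥤ A) := fun X =>
  ∀ (i j k : ℤ) (hij : i ≤ j) (hjk : j ≤ k),
    ∃ w : X.map (Wedge.hom hij (hij.trans hjk) le_rfl hjk) ≫
        X.map (Wedge.hom (hij.trans hjk) hjk hij le_rfl) = 0,
      𝓔.E (ShortComplex.mk _ _ w)

/-- The category of admissible functors `Wedge ⥤ A`. -/
abbrev BiFunA (𝓔 : ExactStructure A) := (isAdm 𝓔).FullSubcategory

theorem isAdm_tilde (𝓔 : ExactStructure A) {X : Wedge ⥤ A} (hX : isAdm 𝓔 X) (φ : Bicofinal) :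
    isAdm 𝓔 (φ.tilde ⋙ X) :=
  fun i j k hij hjk => hX (φ.toFun i) (φ.toFun j) (φ.toFun k) (φ.mono hij) (φ.mono hjk)

/-- The admissible functor `X ∘ φ̃`. -/
def BiFunA.precomp {𝓔 : ExactStructure A} (X : BiFunA 𝓔) (φ : Bicofinal) : BiFunA 𝓔 :=
  ⟨φ.tilde ⋙ X.obj, isAdm_tilde 𝓔 X.property φ⟩

/-- The canonical map `X ∘ φ̃₀ ⟶ X ∘ φ̃₁` for `φ₀ ≤ φ₁`. -/
def BiFunA.precompHom {𝓔 : ExactStructure A} (X : BiFunA 𝓔) {φ₀ φ₁ : Bicofinal}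
    (h : ∀ n, φ₀.toFun n ≤ φ₁.toFun n) : X.precomp φ₀ ⟶ X.precomp φ₁ :=
  ObjectProperty.homMk (Functor.whiskerRight (Bicofinal.tildeHom h) X.obj)

/-- The class `U_a` of all the maps `X ∘ φ̃₀ ⟶ X ∘ φ̃₁`, for `X` admissible and `φ₀ ≤ φ₁` bicofinal. -/
inductive Ua (𝓔 : ExactStructure A) : MorphismProperty (BiFunA 𝓔)
  | mk (X : BiFunA 𝓔) (φ₀ φ₁ : Bicofinal) (h : ∀ n, φ₀.toFun n ≤ φ₁.toFun n) :
      Ua 𝓔 (X.precompHom h)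

/-- The Beilinson category of `A`: the localization of the category of admissible functors at
`U_a`. -/
abbrev Beilinson (𝓔 : ExactStructure A) := (Ua 𝓔).Localization

end Beilinson

/-! ### The functor from the Beilinson category to the admissible Kato category -/

section Comparison

/-- The map `(j, i) ↦ (min i j, j)`, which is the identity on the pairs with `i ≤ j`. The index `i`
runs over the integers with the opposite order, as the index of a pro-system. -/
def retract : ℤ × (ℤᵒᵈ)ᵒᵖ ⥤ Wedge where
  obj p := Wedge.mk (min (OrderDual.ofDual p.2.unop) p.1) p.1 (min_le_right _ _)
  map {p q} f := Wedge.hom _ _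
    (min_le_min (show OrderDual.ofDual p.2.unop ≤ OrderDual.ofDual q.2.unop from f.2.unop.le)
      f.1.le) f.1.le
  map_id _ := Subsingleton.elim _ _
  map_comp _ _ := Subsingleton.elim _ _

variable {A : Type u} [Category.{v} A]

/-- The extension of `X : Wedge ⥤ A` to a bifunctor: for each `j` the pro-system `X_{i,j}`, `i ≤ j`,
is continued by `X_{j,j}` for `i > j`; this does not change its formal limit. -/
def extend : (Wedge ⥤ A) ⥤ (ℤ ⥤ (ℤᵒᵈ)ᵒᵖ ⥤ A) :=
  (Functor.whiskeringLeft _ _ _).obj retract ⋙ Functor.curry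

/-- The functor `X ↦ "colim"_j "lim"_{i ≤ j} X_{i,j}`. -/
def wedgeLim : (Wedge ⥤ A) ⥤ Ind (Pro A) :=
  extend ⋙ indProLim ℤᵒᵈ ℤ

/-- Restriction of a bifunctor along functors of the index categories. -/
abbrev restrict {I J I' J' : Type} [SmallCategory I] [SmallCategory J] [SmallCategory I']
    [SmallCategory J'] (G : I' ⥤ I) (F : J' ⥤ J) (X : J ⥤ Iᵒᵖ ⥤ A) : J' ⥤ I'ᵒᵖ ⥤ A :=
  F ⋙ X ⋙ (Functor.whiskeringLeft _ _ _).obj G.op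

/-- Formal limits do not change under restriction along a cofinal functor. -/
def proRes {I I' : Type} [SmallCategory I] [SmallCategory I'] [IsFiltered I]
    [IsFiltered I'] (G : I' ⥤ I) [G.Final] :
    proLim I ≅ (Functor.whiskeringLeft _ _ A).obj G.op ⋙ proLim I' :=
  Functor.isoWhiskerLeft ((Functor.whiskeringRight _ _ _).obj (Ind.yoneda (C := Aᵒᵖ)).rightOp)
    (Functor.Initial.limIso G.op).symm

/-- The projections of a formal limit. -/
def proπ {I : Type} [SmallCategory I] [IsFiltered I] (Y : Iᵒᵖ ⥤ A) (i : I) :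
    (proLim I).obj Y ⟶ (Ind.yoneda (C := Aᵒᵖ)).rightOp.obj (Y.obj (op i)) :=
  limit.π (Y ⋙ (Ind.yoneda (C := Aᵒᵖ)).rightOp) (op i)

theorem proLim_hom_ext {I : Type} [SmallCategory I] [IsFiltered I] {Y : Iᵒᵖ ⥤ A} {P : Pro A}
    {f g : P ⟶ (proLim I).obj Y} (h : ∀ i, f ≫ proπ Y i = g ≫ proπ Y i) : f = g :=
  limit.hom_ext fun i => h i.unop

theorem proLim_map_π {I : Type} [SmallCategory I] [IsFiltered I] {Y Z : Iᵒᵖ ⥤ A} (f : Y ⟶ Z)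
    (i : I) : (proLim I).map f ≫ proπ Z i =
      proπ Y i ≫ (Ind.yoneda (C := Aᵒᵖ)).rightOp.map (f.app (op i)) :=
  limMap_π _ _

theorem proπ_w {I : Type} [SmallCategory I] [IsFiltered I] (Y : Iᵒᵖ ⥤ A) {i i' : I} (f : i ⟶ i') :
    proπ Y i' ≫ (Ind.yoneda (C := Aᵒᵖ)).rightOp.map (Y.map f.op) = proπ Y i :=
  limit.w (Y ⋙ (Ind.yoneda (C := Aᵒᵖ)).rightOp) f.op

theorem proRes_π {I I' : Type} [SmallCategory I] [SmallCategory I'] [IsFiltered I]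
    [IsFiltered I'] (G : I' ⥤ I) [G.Final] (Y : Iᵒᵖ ⥤ A) (i : I') :
    (proRes G).hom.app Y ≫ proπ (G.op ⋙ Y) i = proπ Y (G.obj i) :=
  limit.pre_π (Y ⋙ (Ind.yoneda (C := Aᵒᵖ)).rightOp) G.op (op i)

theorem indProLim_restrict {I J I' J' : Type} [SmallCategory I] [SmallCategory J]
    [SmallCategory I'] [SmallCategory J'] [IsFiltered I] [IsFiltered I'] [IsFiltered J]
    [IsFiltered J'] (G : I' ⥤ I) [G.Final] (F : J' ⥤ J) [F.Final] (X : J ⥤ Iᵒᵖ ⥤ A) :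
    Nonempty ((indProLim I J).obj X ≅ (indProLim I' J').obj (restrict G F X)) :=
  ⟨(Functor.Final.colimitIso F ((X ⋙ proLim I) ⋙ Ind.yoneda)).symm ≪≫
    (indLim J').mapIso (Functor.isoWhiskerLeft (F ⋙ X) (proRes G))⟩

/-- `φ` as a functor. -/
abbrev Bicofinal.functor (φ : Bicofinal) : ℤ ⥤ ℤ := φ.mono.functor

/-- `φ` as a functor for the opposite order. -/
abbrev Bicofinal.dualFunctor (φ : Bicofinal) : ℤᵒᵈ ⥤ ℤᵒᵈ := φ.mono.dual.functor

instance (φ : Bicofinal) : φ.functor.Final := by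
  rw [Monotone.final_functor_iff]
  intro n
  exact (φ.tendsto_atTop.eventually_ge_atTop n).exists

instance (φ : Bicofinal) : φ.dualFunctor.Final := by
  rw [Monotone.final_functor_iff]
  intro n
  exact (φ.tendsto_atBot.eventually_le_atBot (OrderDual.ofDual n)).exists

theorem wedge_comp (X : Wedge ⥤ A) {p q q' r : Wedge} (f : p ⟶ q) (g : q ⟶ r) (f' : p ⟶ q')
    (g' : q' ⟶ r) : X.map f ≫ X.map g = X.map f' ≫ X.map g' := by
  rw [← X.map_comp, ← X.map_comp]
  rfl

theorem wedge_comp₃ (X : Wedge ⥤ A) {p q q' r s : Wedge} (f : p ⟶ q) (g : q ⟶ r) (h : r ⟶ s)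
    (f' : p ⟶ q') (g' : q' ⟶ s) : (X.map f ≫ X.map g) ≫ X.map h = X.map f' ≫ X.map g' := by
  rw [← X.map_comp, ← X.map_comp, ← X.map_comp]
  rfl

/-- The extension of `X ∘ φ̃` is the restriction of the extension of `X`. -/
def extendTilde (φ : Bicofinal) (X : Wedge ⥤ A) :
    restrict φ.dualFunctor φ.functor (extend.obj X) ≅ extend.obj (φ.tilde ⋙ X) :=
  NatIso.ofComponents (fun j => NatIso.ofComponents (fun i => X.mapIso
      (eqToIso (Subtype.ext (Prod.ext (φ.mono.map_min).symm rfl))))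
      (fun _ => by
        change X.map _ ≫ X.map _ = X.map _ ≫ X.map _
        rw [← X.map_comp, ← X.map_comp]
        rfl))
    (fun _ => by
      ext i
      change X.map _ ≫ X.map _ = X.map _ ≫ X.map _
      rw [← X.map_comp, ← X.map_comp]
      rfl)

/-- The ind-system of formal limits of `X ∘ φ̃`, computed from that of `X`. -/
def tildeSystem (φ : Bicofinal) (X : Wedge ⥤ A) :
    φ.functor ⋙ extend.obj X ⋙ proLim ℤᵒᵈ ≅ extend.obj (φ.tilde ⋙ X) ⋙ proLim ℤᵒᵈ :=
  Functor.isoWhiskerLeft (φ.functor ⋙ extend.obj X) (proRes φ.dualFunctor) ≪≫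
    Functor.isoWhiskerRight (extendTilde φ X) (proLim ℤᵒᵈ)

/-- The transformation between the functors attached to `φ₀ ≤ φ₁`. -/
def Bicofinal.functorHom {φ₀ φ₁ : Bicofinal} (h : ∀ n, φ₀.toFun n ≤ φ₁.toFun n) :
    φ₀.functor ⟶ φ₁.functor where
  app n := homOfLE (h n)
  naturality _ _ _ := Subsingleton.elim _ _

theorem tildeSystem_π (φ : Bicofinal) (X : Wedge ⥤ A) (j : ℤ) (i : ℤᵒᵈ) :
    (tildeSystem φ X).hom.app j ≫ proπ ((extend.obj (φ.tilde ⋙ X)).obj j) i =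
      proπ ((extend.obj X).obj (φ.toFun j)) (φ.dualFunctor.obj i) ≫
        (Ind.yoneda (C := Aᵒᵖ)).rightOp.map (((extendTilde φ X).hom.app j).app (op i)) := by
  have e₁ := proLim_map_π ((extendTilde φ X).hom.app j) i
  have e₂ := proRes_π φ.dualFunctor ((extend.obj X).obj (φ.toFun j)) i
  exact (Category.assoc _ _ _).trans ((congrArg (fun t => (proRes φ.dualFunctor).hom.app
    ((extend.obj X).obj (φ.toFun j)) ≫ t) e₁).trans ((Category.assoc _ _ _).symm.trans
      (congrArg (fun t => t ≫ (Ind.yoneda (C := Aᵒᵖ)).rightOp.map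
        (((extendTilde φ X).hom.app j).app (op i))) e₂)))

theorem tildeSystem_naturality {φ₀ φ₁ : Bicofinal} (h : ∀ n, φ₀.toFun n ≤ φ₁.toFun n)
    (X : Wedge ⥤ A) :
    Functor.whiskerRight (Bicofinal.functorHom h) (extend.obj X ⋙ proLim ℤᵒᵈ) ≫
        (tildeSystem φ₁ X).hom =
      (tildeSystem φ₀ X).hom ≫ Functor.whiskerRight
        (extend.map (Functor.whiskerRight (Bicofinal.tildeHom h) X)) (proLim ℤᵒᵈ) := by
  ext j : 2
  apply proLim_hom_ext
  intro i
  have e₁ : (proLim ℤᵒᵈ).map ((extend.obj X).map (homOfLE (h j))) ≫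
      proπ ((extend.obj X).obj (φ₁.toFun j)) (φ₁.dualFunctor.obj i) =
      proπ ((extend.obj X).obj (φ₀.toFun j)) (φ₀.dualFunctor.obj i) ≫
        (Ind.yoneda (C := Aᵒᵖ)).rightOp.map (((extend.obj X).obj (φ₀.toFun j)).map
          (homOfLE (show φ₁.dualFunctor.obj i ≤ φ₀.dualFunctor.obj i from h _)).op ≫
        ((extend.obj X).map (homOfLE (h j))).app (op (φ₁.dualFunctor.obj i))) := by
    rw [proLim_map_π, Functor.map_comp, ← Category.assoc, proπ_w]
  have e₂ := tildeSystem_π φ₁ X j i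
  have e₃ := tildeSystem_π φ₀ X j i
  have e₄ := proLim_map_π ((extend.map (Functor.whiskerRight (Bicofinal.tildeHom h) X)).app j) i
  change ((proLim ℤᵒᵈ).map ((extend.obj X).map (homOfLE (h j))) ≫
    (tildeSystem φ₁ X).hom.app j) ≫ _ = ((tildeSystem φ₀ X).hom.app j ≫ (proLim ℤᵒᵈ).map
      ((extend.map (Functor.whiskerRight (Bicofinal.tildeHom h) X)).app j)) ≫ _
  have e₅ : (((extend.obj X).obj (φ₀.toFun j)).map
          (homOfLE (show φ₁.dualFunctor.obj i ≤ φ₀.dualFunctor.obj i from h _)).op ≫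
        ((extend.obj X).map (homOfLE (h j))).app (op (φ₁.dualFunctor.obj i))) ≫
        ((extendTilde φ₁ X).hom.app j).app (op i) =
      ((extendTilde φ₀ X).hom.app j).app (op i) ≫
        ((extend.map (Functor.whiskerRight (Bicofinal.tildeHom h) X)).app j).app (op i) :=
    wedge_comp₃ X _ _ _ _ _
  have e₆ := (Functor.map_comp _ _ _).symm.trans
    ((congrArg (Ind.yoneda (C := Aᵒᵖ)).rightOp.map e₅).trans (Functor.map_comp _ _ _))
  refine (Category.assoc _ _ _).trans ((congrArg _ e₂).trans ?_)
  refine Eq.trans ?_ ((Category.assoc _ _ _).trans (congrArg _ e₄)).symm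
  refine (Category.assoc _ _ _).symm.trans ((congrArg (fun t => t ≫ _) e₁).trans ?_)
  refine Eq.trans ?_ ((Category.assoc _ _ _).symm.trans (congrArg (fun t => t ≫ _) e₃)).symm
  exact (Category.assoc _ _ _).trans ((congrArg _ e₆).trans (Category.assoc _ _ _).symm)

theorem wedgeLim_isIso {φ₀ φ₁ : Bicofinal} (h : ∀ n, φ₀.toFun n ≤ φ₁.toFun n) (X : Wedge ⥤ A) :
    IsIso (wedgeLim.map (Functor.whiskerRight (Bicofinal.tildeHom h) X)) := by
  set P := extend.obj X ⋙ proLim ℤᵒᵈ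
  let m := Functor.whiskerRight (Bicofinal.functorHom h) P
  have tri : (indLim ℤ).map m ≫ colimit.pre (P ⋙ Ind.yoneda) φ₁.functor =
      colimit.pre (P ⋙ Ind.yoneda) φ₀.functor := by
    apply colimit.hom_ext
    intro j
    have e₁ : colimit.ι (φ₀.functor ⋙ P ⋙ Ind.yoneda) j ≫ (indLim ℤ).map m =
        Ind.yoneda.map (m.app j) ≫ colimit.ι (φ₁.functor ⋙ P ⋙ Ind.yoneda) j :=
      ι_colimMap (Functor.whiskerRight m Ind.yoneda) j
    have e₂ := colimit.ι_pre (P ⋙ Ind.yoneda) φ₁.functor j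
    have e₃ := colimit.ι_pre (P ⋙ Ind.yoneda) φ₀.functor j
    have e₄ := colimit.w (P ⋙ Ind.yoneda) (homOfLE (h j))
    refine (Category.assoc _ _ _).symm.trans ((congrArg (fun t => t ≫ _) e₁).trans ?_)
    exact (Category.assoc _ _ _).trans ((congrArg _ e₂).trans (e₄.trans e₃.symm))
  have h₀ : IsIso (colimit.pre (P ⋙ Ind.yoneda) φ₀.functor) :=
    Functor.Final.colimit_pre_isIso φ₀.functor
  have h₁ : IsIso (colimit.pre (P ⋙ Ind.yoneda) φ₁.functor) :=
    Functor.Final.colimit_pre_isIso φ₁.functor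
  have hm : IsIso ((indLim ℤ).map m) := by
    have : IsIso ((indLim ℤ).map m ≫ colimit.pre (P ⋙ Ind.yoneda) φ₁.functor) := by
      rw [tri]; exact h₀
    exact @IsIso.of_isIso_comp_right _ _ _ _ _ _ (colimit.pre (P ⋙ Ind.yoneda) φ₁.functor) h₁ this
  have sq := congrArg (indLim ℤ).map (tildeSystem_naturality h X)
  rw [Functor.map_comp, Functor.map_comp] at sq
  have : IsIso ((indLim ℤ).map (tildeSystem φ₀ X).hom ≫ (indLim ℤ).map (Functor.whiskerRight
        (extend.map (Functor.whiskerRight (Bicofinal.tildeHom h) X)) (proLim ℤᵒᵈ))) := by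
    rw [← sq]; exact IsIso.comp_isIso' hm inferInstance
  exact @IsIso.of_isIso_comp_left _ _ _ _ _ ((indLim ℤ).map (tildeSystem φ₀ X).hom) _
    inferInstance this

variable [Preadditive A] [HasZeroObject A] [HasBinaryBiproducts A]

theorem isAdm.admEpi {𝓔 : ExactStructure A} {X : Wedge ⥤ A} (hX : isAdm 𝓔 X)
    {i i' j : ℤ} (hi : i ≤ i') (hij : i' ≤ j) :
    IsAdmEpi 𝓔.E (X.map (Wedge.hom (hi.trans hij) hij hi le_rfl)) :=
  let ⟨w, hw⟩ := hX i i' j hi hij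
  ⟨_, _, w, hw⟩

theorem isAdm.admMono {𝓔 : ExactStructure A} {X : Wedge ⥤ A} (hX : isAdm 𝓔 X)
    {i j j' : ℤ} (hij : i ≤ j) (hj : j ≤ j') :
    IsAdmMono 𝓔.E (X.map (Wedge.hom hij (hij.trans hj) le_rfl hj)) :=
  let ⟨w, hw⟩ := hX i j j' hij hj
  ⟨_, _, w, hw⟩

theorem isAdm.isPullback {𝓔 : ExactStructure A} {X : Wedge ⥤ A} (hX : isAdm 𝓔 X)
    {i i' j j' : ℤ} (hi : i ≤ i') (hij : i' ≤ j) (hj : j ≤ j') :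
    IsPullback (X.map (Wedge.hom (hi.trans hij) (hi.trans (hij.trans hj)) le_rfl hj))
      (X.map (Wedge.hom (hi.trans hij) hij hi le_rfl))
      (X.map (Wedge.hom (hi.trans (hij.trans hj)) (hij.trans hj) hi le_rfl))
      (X.map (Wedge.hom hij (hij.trans hj) le_rfl hj)) := by
  have comm := wedge_comp X (Wedge.hom (hi.trans hij) (hi.trans (hij.trans hj)) le_rfl hj)
    (Wedge.hom (hi.trans (hij.trans hj)) (hij.trans hj) hi le_rfl)
    (Wedge.hom (hi.trans hij) hij hi le_rfl) (Wedge.hom hij (hij.trans hj) le_rfl hj)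
  obtain ⟨w₁, hw₁⟩ := hX i j j' (hi.trans hij) hj
  obtain ⟨w₂, hw₂⟩ := hX i' j j' hij hj
  obtain ⟨k₁⟩ := 𝓔.isKernel _ hw₁
  obtain ⟨k₂⟩ := 𝓔.isKernel _ hw₂
  have m₁ := mono_of_isLimit_fork k₁
  have m₂ := mono_of_isLimit_fork k₂
  dsimp at m₁ m₂
  have tri : X.map (Wedge.hom (hi.trans (hij.trans hj)) hj (hi.trans hij) le_rfl) =
      X.map (Wedge.hom (hi.trans (hij.trans hj)) (hij.trans hj) hi le_rfl) ≫
        X.map (Wedge.hom (hij.trans hj) hj hij le_rfl) := (X.map_comp _ _)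
  refine ⟨⟨comm⟩, ⟨PullbackCone.IsLimit.mk comm
    (fun c => k₁.lift (KernelFork.ofι c.fst ?_)) (fun c => ?_) (fun c => ?_) (fun c m h _ => ?_)⟩⟩
  · change c.fst ≫ X.map _ = 0
    rw [tri, ← Category.assoc, c.condition, Category.assoc]
    exact (congrArg (fun t => c.snd ≫ t) w₂).trans comp_zero
  · exact k₁.fac (KernelFork.ofι c.fst _) WalkingParallelPair.zero
  · rw [← cancel_mono (X.map (Wedge.hom hij (hij.trans hj) le_rfl hj)), Category.assoc, ← comm,
      ← Category.assoc]
    exact (congrArg (fun t => t ≫ _)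
      (k₁.fac (KernelFork.ofι c.fst _) WalkingParallelPair.zero)).trans c.condition
  · rw [← cancel_mono (X.map (Wedge.hom (hi.trans hij) (hi.trans (hij.trans hj)) le_rfl hj)), h]
    exact (k₁.fac (KernelFork.ofι c.fst _) WalkingParallelPair.zero).symm

theorem isAdm.admMono' {𝓔 : ExactStructure A} {X : Wedge ⥤ A} (hX : isAdm 𝓔 X)
    {i i₁ j j' : ℤ} (e : i = i₁) (hij : i ≤ j) (hj : j ≤ j') :
    IsAdmMono 𝓔.E (X.map (Wedge.hom hij (e.ge.trans (hij.trans hj)) e.le hj)) := by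
  subst e
  exact hX.admMono hij hj

theorem isAdm.isPullback' {𝓔 : ExactStructure A} {X : Wedge ⥤ A} (hX : isAdm 𝓔 X)
    {i i₁ i' i₁' j j' : ℤ} (e : i = i₁) (e' : i' = i₁') (hi : i ≤ i') (hij : i' ≤ j)
    (hj : j ≤ j') :
    IsPullback
      (X.map (Wedge.hom (hi.trans hij) (e.ge.trans (hi.trans (hij.trans hj))) e.le hj))
      (X.map (Wedge.hom (hi.trans hij) hij hi le_rfl))
      (X.map (Wedge.hom (e.ge.trans (hi.trans (hij.trans hj))) (e'.ge.trans (hij.trans hj))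
        (e.ge.trans (hi.trans e'.le)) le_rfl))
      (X.map (Wedge.hom hij (e'.ge.trans (hij.trans hj)) e'.le hj)) := by
  subst e e'
  exact hX.isPullback hi hij hj

/-- The formal limit of an admissible functor `Wedge ⥤ A` is in the admissible Kato category: it
may be computed over the pairs `(i, j)` with `i ≤ 0 ≤ j`. -/
theorem isKato_wedgeLim {𝓔 : ExactStructure A} {X : Wedge ⥤ A} (hX : isAdm 𝓔 X) :
    isKato 𝓔 (wedgeLim.obj X) := by
  have hF : Monotone (fun n : ℕ => (n : ℤ)) := fun a b h => Int.ofNat_le.2 h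
  have hG : Monotone (fun n : ℕ => OrderDual.toDual (-(n : ℤ))) := fun a b h =>
    show -(b : ℤ) ≤ -(a : ℤ) from neg_le_neg (Int.ofNat_le.2 h)
  have : hF.functor.Final := by
    rw [Monotone.final_functor_iff]
    exact fun n => ⟨n.toNat, Int.self_le_toNat n⟩
  have : hG.functor.Final := by
    rw [Monotone.final_functor_iff]
    exact fun n => ⟨(-(OrderDual.ofDual n)).toNat,
      show -((-(OrderDual.ofDual n)).toNat : ℤ) ≤ OrderDual.ofDual n from
        neg_le.1 (Int.self_le_toNat _)⟩
  refine ⟨ℕ, ℕ, inferInstance, inferInstance, inferInstance, inferInstance, inferInstance,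
    inferInstance, restrict hG.functor hF.functor (extend.obj X), ⟨?_, ?_⟩, ?_,
    indProLim_restrict hG.functor hF.functor (extend.obj X)⟩
  · intro j i i' f
    have hf : i ≤ i' := f.le
    exact hX.admEpi (i := min (-(i' : ℤ)) j) (i' := min (-(i : ℤ)) j) (j := j) (by omega)
      (by omega)
  · intro i j j' g
    have hg : j ≤ j' := g.le
    exact hX.admMono' (i := min (-(i : ℤ)) j) (i₁ := min (-(i : ℤ)) j') (j := j) (j' := j')
      (by omega) (by omega) (by omega)
  · intro i i' f j j' g
    have hf : i ≤ i' := f.le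
    have hg : j ≤ j' := g.le
    exact hX.isPullback' (i := min (-(i' : ℤ)) j) (i₁ := min (-(i' : ℤ)) j')
      (i' := min (-(i : ℤ)) j) (i₁' := min (-(i : ℤ)) j') (j := j) (j' := j')
      (by omega) (by omega) (by omega) (by omega) (by omega)

/-- The functor from admissible functors `Wedge ⥤ A` to the admissible Kato category given by
`X ↦ "colim"_j "lim"_{i ≤ j} X_{i,j}`. -/
def biFunToKato (𝓔 : ExactStructure A) : BiFunA 𝓔 ⥤ Kato 𝓔 :=
  ObjectProperty.lift _
    (ObjectProperty.lift _ ((isAdm 𝓔).ι ⋙ wedgeLim)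
      (fun X => isKato_le_isIPa 𝓔 _ (isKato_wedgeLim X.property)))
    (fun X => isKato_wedgeLim X.property)

theorem biFunToKato_inverts (𝓔 : ExactStructure A) : (Ua 𝓔).IsInvertedBy (biFunToKato 𝓔) := by
  rintro _ _ _ ⟨X, φ₀, φ₁, h⟩
  have : IsIso ((isIPa 𝓔).ι.map (((isKato 𝓔).inverseImage (isIPa 𝓔).ι).ι.map
    ((biFunToKato 𝓔).map (X.precompHom h)))) := wedgeLim_isIso h X.obj
  have := isIso_of_reflects_iso (((isKato 𝓔).inverseImage (isIPa 𝓔).ι).ι.map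
    ((biFunToKato 𝓔).map (X.precompHom h))) (isIPa 𝓔).ι
  exact isIso_of_reflects_iso _ ((isKato 𝓔).inverseImage (isIPa 𝓔).ι).ι

/-- The embedding of the Beilinson category in the admissible Kato category: the functor induced on
the localization by `X ↦ "colim"_j "lim"_{i ≤ j} X_{i,j}`. -/
def embedding (𝓔 : ExactStructure A) : Beilinson 𝓔 ⥤ Kato 𝓔 :=
  Localization.Construction.lift (biFunToKato 𝓔) (biFunToKato_inverts 𝓔)

end Comparison

end LocCompact

end

/-!
Write `X_j` for the pro-object `"lim"_{i ≤ j} X_{i,j}` of a functor `X : Wedge ⥤ A`. If `X` is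
admissible, the squares of `X` are bicartesian and its diagonal is zero, so the maps `X_j ⟶ X_k` are
monic and `X_{i,j}` is the cokernel of `X_i ⟶ X_j`, at least against maps to objects of `A`.
Maps between the sequences of pro-objects of `X` and `Y` therefore come from unique natural
transformations `X ⟶ Y`. A map between the ind-objects becomes such a map of sequences once `Y` is
replaced by `Y ∘ φ̃` for a large bicofinal `φ`, that is, after composition with one of the inverted
maps `Y ⟶ Y ∘ φ̃`. As these maps admit a calculus of left fractions, the functor on the
localization is fully faithful.

For essential surjectivity, index a presentation by sequences and place it on the quadrant
`i < 0 ≤ j` of the wedge. Continue it by zero to a system `V_{i,j}` with `V_{i,j} = 0` for `i ≥ 0`,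
and let `K_{i,j}` be the kernel of `V_{i,j} ⟶ V_{j,j}`. The cokernels of
`K_{min(i,-1),i} ⟶ K_{min(i,-1),j}` form an admissible functor that has the given values on the
quadrant, hence the given ind-pro-limit.
-/

noncomputable section

namespace LocCompact

section IndProHoms

variable {C : Type u} [Category.{v} C]

/-- Maps out of a representable ind-object are the sections of the underlying presheaf. -/
def coyonedaIndYoneda (P : C) :
    coyoneda.obj (op (Ind.yoneda.obj P)) ≅
      Ind.inclusion C ⋙ (CategoryTheory.evaluation _ _).obj (op P) :=
  NatIso.ofComponents (fun Y => Equiv.toIso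
    (Ind.inclusion.fullyFaithful.homEquiv.trans
      (((Ind.yonedaCompInclusion.app P).homCongr (Iso.refl _)).trans yonedaEquiv)))
    (fun {Y Z} f => by
      ext g
      simp [yonedaEquiv, Functor.FullyFaithful.homEquiv])

instance (P : C) (J : Type) [SmallCategory J] [IsFiltered J] :
    PreservesColimitsOfShape J (coyoneda.obj (op (Ind.yoneda.obj P))) := by
  have : PreservesFilteredColimitsOfSize.{v, v} (Ind.inclusion C) := ⟨fun J _ _ => inferInstance⟩
  have : PreservesFilteredColimitsOfSize.{0, 0} (Ind.inclusion C) :=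
    preservesFilteredColimitsOfSize_of_univLE.{v, v} _
  have : PreservesColimitsOfShape J (Ind.inclusion C) :=
    PreservesFilteredColimitsOfSize.preserves_filtered_colimits J
  exact preservesColimitsOfShape_of_natIso (coyonedaIndYoneda P).symm

variable {J : Type} [SmallCategory J] [IsFiltered J]

/-- The structure maps of a formal colimit. -/
def indι (Y : J ⥤ C) (j : J) : Ind.yoneda.obj (Y.obj j) ⟶ (indLim J).obj Y :=
  colimit.ι (Y ⋙ Ind.yoneda) j

theorem indLim_hom_ext {Y : J ⥤ C} {P : Ind C} {f g : (indLim J).obj Y ⟶ P}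
    (h : ∀ j, indι Y j ≫ f = indι Y j ≫ g) : f = g :=
  colimit.hom_ext h

theorem indι_w (Y : J ⥤ C) {j j' : J} (f : j ⟶ j') :
    Ind.yoneda.map (Y.map f) ≫ indι Y j' = indι Y j :=
  colimit.w (Y ⋙ Ind.yoneda) f

theorem indι_map {Y Z : J ⥤ C} (f : Y ⟶ Z) (j : J) :
    indι Y j ≫ (indLim J).map f = Ind.yoneda.map (f.app j) ≫ indι Z j :=
  ι_colimMap (Functor.whiskerRight f Ind.yoneda) j

theorem exists_factor_indι (Y : J ⥤ C) {P : C} (f : Ind.yoneda.obj P ⟶ (indLim J).obj Y) :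
    ∃ (j : J) (g : P ⟶ Y.obj j), Ind.yoneda.map g ≫ indι Y j = f := by
  obtain ⟨j, g, hg⟩ := exists_hom_of_preservesColimit_coyoneda
    (colimit.isColimit (Y ⋙ Ind.yoneda)) f
  obtain ⟨g, rfl⟩ := Ind.yoneda.map_surjective g
  exact ⟨j, g, hg⟩

theorem exists_eq_of_indι_eq (Y : J ⥤ C) {P : C} {j : J} (f g : P ⟶ Y.obj j)
    (h : Ind.yoneda.map f ≫ indι Y j = Ind.yoneda.map g ≫ indι Y j) :
    ∃ (j' : J) (t : j ⟶ j'), f ≫ Y.map t = g ≫ Y.map t := by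
  obtain ⟨j', t, ht⟩ := exists_eq_of_preservesColimit_coyoneda_self
    (colimit.isColimit (Y ⋙ Ind.yoneda)) (Ind.yoneda.map f) (Ind.yoneda.map g) h
  refine ⟨j', t, Ind.yoneda.map_injective ?_⟩
  rw [Functor.map_comp, Functor.map_comp]
  exact ht

variable (C) in
/-- The embedding of a category in its pro-objects. -/
abbrev proConst : C ⥤ Pro C := (Ind.yoneda (C := Cᵒᵖ)).rightOp

/-- A formal limit is, in the opposite category, a colimit of ind-objects. -/
def isColimitProLim (Y : Jᵒᵖ ⥤ C) :
    IsColimit (coconeUnopOfCone (limit.cone (Y ⋙ proConst C))) :=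
  isColimitCoconeUnopOfCone _ (limit.isLimit (Y ⋙ proConst C))

theorem exists_factor_proπ (Y : Jᵒᵖ ⥤ C) {a : C} (f : (proLim J).obj Y ⟶ (proConst C).obj a) :
    ∃ (j : J) (g : Y.obj (op j) ⟶ a), proπ Y j ≫ (proConst C).map g = f := by
  obtain ⟨j, g, hg⟩ := exists_hom_of_preservesColimit_coyoneda (isColimitProLim Y)
    (X := Ind.yoneda.obj (op a)) f.unop
  obtain ⟨g, rfl⟩ := (Ind.yoneda (C := Cᵒᵖ)).map_surjective g
  exact ⟨j, g.unop, Quiver.Hom.unop_inj hg⟩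

theorem exists_eq_of_proπ_eq (Y : Jᵒᵖ ⥤ C) {a : C} {j : J} (f g : Y.obj (op j) ⟶ a)
    (h : proπ Y j ≫ (proConst C).map f = proπ Y j ≫ (proConst C).map g) :
    ∃ (j' : J) (t : j ⟶ j'), Y.map t.op ≫ f = Y.map t.op ≫ g := by
  obtain ⟨j', t, ht⟩ := exists_eq_of_preservesColimit_coyoneda_self (isColimitProLim Y)
    (X := Ind.yoneda.obj (op a)) (Ind.yoneda.map f.op) (Ind.yoneda.map g.op)
    (congrArg Quiver.Hom.unop h)
  refine ⟨j', t, (proConst C).map_injective (Quiver.Hom.unop_inj ?_)⟩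
  rw [Functor.map_comp, Functor.map_comp]
  exact ht

instance : PreservesFiniteLimits (proConst C) :=
  preservesFiniteLimits_rightOp _

end IndProHoms

section ZeroCorner

variable {C : Type u} [Category.{v} C] [HasZeroMorphisms C]

theorem isPullback_iff_isKernel {a b c z : C} (hz : IsZero z) {f : a ⟶ b} {p : a ⟶ z} {g : b ⟶ c}
    {q : z ⟶ c} :
    IsPullback f p g q ↔ ∃ w : f ≫ g = 0, Nonempty (IsLimit (KernelFork.ofι f w)) := by
  obtain rfl := hz.eq_zero_of_tgt p
  obtain rfl := hz.eq_zero_of_src q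
  constructor
  · intro h
    refine ⟨by rw [h.w, comp_zero], ⟨KernelFork.IsLimit.ofι _ _
      (fun t ht => h.lift t 0 (by rw [ht, comp_zero])) (fun t ht => h.lift_fst _ _ _)
      (fun t ht m hm => h.hom_ext ?_ (hz.eq_of_tgt _ _))⟩⟩
    rw [hm, h.lift_fst]
  · rintro ⟨w, ⟨h⟩⟩
    have : Mono f := mono_of_isLimit_fork h
    refine ⟨⟨by rw [w, comp_zero]⟩, ⟨PullbackCone.IsLimit.mk _
      (fun s => h.lift (KernelFork.ofι s.fst (by rw [s.condition, comp_zero])))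
      (fun s => h.fac (KernelFork.ofι s.fst _) WalkingParallelPair.zero)
      (fun s => hz.eq_of_tgt _ _) (fun s m hm _ => ?_)⟩⟩
    rw [← cancel_mono f, hm]
    exact (h.fac (KernelFork.ofι s.fst _) WalkingParallelPair.zero).symm

theorem isPushout_iff_isCokernel {a b c z : C} (hz : IsZero z) {f : a ⟶ b} {p : a ⟶ z}
    {g : b ⟶ c} {q : z ⟶ c} :
    IsPushout f p g q ↔ ∃ w : f ≫ g = 0, Nonempty (IsColimit (CokernelCofork.ofπ g w)) := by
  obtain rfl := hz.eq_zero_of_tgt p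
  obtain rfl := hz.eq_zero_of_src q
  constructor
  · intro h
    refine ⟨by rw [h.w, zero_comp], ⟨CokernelCofork.IsColimit.ofπ _ _
      (fun t ht => h.desc t 0 (by rw [ht, zero_comp])) (fun t ht => h.inl_desc _ _ _)
      (fun t ht m hm => h.hom_ext ?_ (hz.eq_of_src _ _))⟩⟩
    rw [hm, h.inl_desc]
  · rintro ⟨w, ⟨h⟩⟩
    have : Epi g := epi_of_isColimit_cofork h
    refine ⟨⟨by rw [w, zero_comp]⟩, ⟨PushoutCocone.IsColimit.mk _
      (fun s => h.desc (CokernelCofork.ofπ s.inl (by rw [s.condition, zero_comp])))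
      (fun s => h.fac (CokernelCofork.ofπ s.inl _) WalkingParallelPair.one)
      (fun s => hz.eq_of_src _ _) (fun s m hm _ => ?_)⟩⟩
    rw [← cancel_epi g, hm]
    exact (h.fac (CokernelCofork.ofπ s.inl _) WalkingParallelPair.one).symm

end ZeroCorner

section ExactLemmas

variable {A : Type u} [Category.{v} A] [Preadditive A] [HasZeroObject A]
  [HasBinaryBiproducts A] (𝓔 : ExactStructure A)

theorem ExactStructure.mem_of_isCokernel {a b c : A} {f : a ⟶ b} {g : b ⟶ c} (w : f ≫ g = 0)
    (hf : IsAdmMono 𝓔.E f) (hg : IsColimit (CokernelCofork.ofπ g w)) :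
    𝓔.E (ShortComplex.mk f g w) := by
  obtain ⟨c', g', w', h⟩ := hf
  obtain ⟨hg'⟩ := 𝓔.isCokernel _ h
  refine 𝓔.of_iso (ShortComplex.mk f g' w') (ShortComplex.mk f g w)
    (ShortComplex.isoMk (Iso.refl _) (Iso.refl _) (hg'.coconePointUniqueUpToIso hg)
      (by simp) ?_) h
  have := hg'.comp_coconePointUniqueUpToIso_hom hg WalkingParallelPair.one
  dsimp at this ⊢
  rw [Category.id_comp]
  exact this.symm

theorem ExactStructure.mem_of_isKernel {a b c : A} {f : a ⟶ b} {g : b ⟶ c} (w : f ≫ g = 0)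
    (hg : IsAdmEpi 𝓔.E g) (hf : IsLimit (KernelFork.ofι f w)) :
    𝓔.E (ShortComplex.mk f g w) := by
  obtain ⟨a', f', w', h⟩ := hg
  obtain ⟨hf'⟩ := 𝓔.isKernel _ h
  refine 𝓔.of_iso (ShortComplex.mk f' g w') (ShortComplex.mk f g w)
    (ShortComplex.isoMk (hf'.conePointUniqueUpToIso hf) (Iso.refl _) (Iso.refl _) ?_
      (by simp)) h
  have := hf'.conePointUniqueUpToIso_hom_comp hf WalkingParallelPair.zero
  dsimp at this ⊢
  rw [Category.comp_id]
  exact this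

variable {𝓔}

theorem IsAdmMono.mono {a b : A} {f : a ⟶ b} (hf : IsAdmMono 𝓔.E f) : Mono f := by
  obtain ⟨c, g, w, h⟩ := hf
  obtain ⟨k⟩ := 𝓔.isKernel _ h
  exact mono_of_isLimit_fork k

theorem IsAdmEpi.epi {b c : A} {g : b ⟶ c} (hg : IsAdmEpi 𝓔.E g) : Epi g := by
  obtain ⟨a, f, w, h⟩ := hg
  obtain ⟨k⟩ := 𝓔.isCokernel _ h
  exact epi_of_isColimit_cofork k

theorem IsAdmMono.hasCokernel {a b : A} {f : a ⟶ b} (hf : IsAdmMono 𝓔.E f) : HasCokernel f := by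
  obtain ⟨c, g, w, h⟩ := hf
  obtain ⟨k⟩ := 𝓔.isCokernel _ h
  exact ⟨⟨⟨_, k⟩⟩⟩

theorem IsAdmEpi.hasKernel {b c : A} {g : b ⟶ c} (hg : IsAdmEpi 𝓔.E g) : HasKernel g := by
  obtain ⟨a, f, w, h⟩ := hg
  obtain ⟨k⟩ := 𝓔.isKernel _ h
  exact ⟨⟨⟨_, k⟩⟩⟩

theorem IsAdmMono.of_iso {a b a' b' : A} {f : a ⟶ b} {f' : a' ⟶ b'} (hf : IsAdmMono 𝓔.E f)
    (e₁ : a ≅ a') (e₂ : b ≅ b') (h : f ≫ e₂.hom = e₁.hom ≫ f') : IsAdmMono 𝓔.E f' := by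
  obtain ⟨c, g, w, hE⟩ := hf
  have w' : f' ≫ e₂.inv ≫ g = 0 := by
    rw [← cancel_epi e₁.hom, ← reassoc_of% h, Iso.hom_inv_id_assoc, w, comp_zero]
  exact ⟨c, e₂.inv ≫ g, w', 𝓔.of_iso (ShortComplex.mk f g w) (ShortComplex.mk f' _ w')
    (ShortComplex.isoMk e₁ e₂ (Iso.refl _) h.symm (by simp)) hE⟩

theorem IsAdmEpi.of_iso {a b a' b' : A} {f : a ⟶ b} {f' : a' ⟶ b'} (hf : IsAdmEpi 𝓔.E f)
    (e₁ : a ≅ a') (e₂ : b ≅ b') (h : f ≫ e₂.hom = e₁.hom ≫ f') : IsAdmEpi 𝓔.E f' := by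
  obtain ⟨c, g, w, hE⟩ := hf
  have w' : (g ≫ e₁.hom) ≫ f' = 0 := by
    rw [Category.assoc, ← h, reassoc_of% w, zero_comp]
  exact ⟨c, g ≫ e₁.hom, w', 𝓔.of_iso (ShortComplex.mk g f w) (ShortComplex.mk _ f' w')
    (ShortComplex.isoMk (Iso.refl _) e₁ e₂ (by simp) h.symm) hE⟩

theorem IsAdmMono.of_isPushout {a a' b b' : A} {i : a ⟶ a'} {f : a ⟶ b} {f' : a' ⟶ b'}
    {i' : b ⟶ b'} (hi : IsAdmMono 𝓔.E i) (h : IsPushout i f f' i') : IsAdmMono 𝓔.E i' := by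
  obtain ⟨c, i'', f'', h', hi''⟩ := 𝓔.exists_pushout i f hi
  exact hi''.of_iso (Iso.refl _) (h'.isoIsPushout _ _ h.flip) (by simp)

theorem IsAdmEpi.of_isPullback {a' a'' b' b'' : A} {f' : b' ⟶ a'} {j' : b' ⟶ b''} {j : a' ⟶ a''}
    {f : b'' ⟶ a''} (hj : IsAdmEpi 𝓔.E j) (h : IsPullback f' j' j f) : IsAdmEpi 𝓔.E j' := by
  obtain ⟨c, j'', f'', h', hj''⟩ := 𝓔.exists_pullback j f hj
  exact hj''.of_iso (h'.isoIsPullback _ _ h.flip) (Iso.refl _) (by simp)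

variable (𝓔) in
theorem isAdmMono_of_isZero {a b : A} (ha : IsZero a) (f : a ⟶ b) : IsAdmMono 𝓔.E f := by
  refine IsAdmMono.of_iso ⟨_, _, _, 𝓔.split a b⟩ (Iso.refl a)
    ⟨biprod.snd, biprod.inr, ?_, ?_⟩ (ha.eq_of_src _ _)
  · rw [← biprod.total, ha.eq_zero_of_src (biprod.inl : a ⟶ a ⊞ b), comp_zero, zero_add]
  · simp

variable (𝓔) in
theorem isAdmEpi_of_isZero {a b : A} (hb : IsZero b) (f : a ⟶ b) : IsAdmEpi 𝓔.E f := by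
  refine IsAdmEpi.of_iso ⟨_, _, _, 𝓔.split a b⟩ ⟨biprod.fst, biprod.inl, ?_, ?_⟩ (Iso.refl b)
    (hb.eq_of_tgt _ _)
  · rw [← biprod.total, hb.eq_zero_of_src (biprod.inr : b ⟶ a ⊞ b), comp_zero, add_zero]
  · simp

end ExactLemmas

section AdmissibleAt

variable {A : Type u} [Category.{v} A] [Preadditive A] [HasZeroObject A]
  [HasBinaryBiproducts A] {𝓔 : ExactStructure A} {X : Wedge ⥤ A} {i j k l : ℤ}

variable (𝓔 X) in
/-- The condition of admissibility of `X : Wedge ⥤ A` for one triple of indices: the sequence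
`X_{i,j} ⟶ X_{i,k} ⟶ X_{j,k}` is an admissible short exact sequence. -/
def IsAdmAt (hij : i ≤ j) (hjk : j ≤ k) : Prop :=
  ∃ w : X.map (Wedge.hom hij (hij.trans hjk) le_rfl hjk) ≫
      X.map (Wedge.hom (hij.trans hjk) hjk hij le_rfl) = 0,
    𝓔.E (ShortComplex.mk _ _ w)

theorem IsAdmAt.admMono {hij : i ≤ j} {hjk : j ≤ k} (h : IsAdmAt 𝓔 X hij hjk) :
    IsAdmMono 𝓔.E (X.map (Wedge.hom hij (hij.trans hjk) le_rfl hjk)) :=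
  let ⟨w, hw⟩ := h
  ⟨_, _, w, hw⟩

/-- The square with vertices `X_{i,k}`, `X_{i,l}`, `X_{j,k}`, `X_{j,l}` is cocartesian. -/
def IsCocartesianAt (X : Wedge ⥤ A) (hij : i ≤ j) (hjk : j ≤ k) (hkl : k ≤ l) : Prop :=
  IsPushout (X.map (Wedge.hom (hij.trans hjk) (hij.trans (hjk.trans hkl)) le_rfl hkl))
    (X.map (Wedge.hom (hij.trans hjk) hjk hij le_rfl))
    (X.map (Wedge.hom (hij.trans (hjk.trans hkl)) (hjk.trans hkl) hij le_rfl))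
    (X.map (Wedge.hom hjk (hjk.trans hkl) le_rfl hkl))

theorem IsAdmAt.isCocartesianAt_diag {hij : i ≤ j} {hjk : j ≤ k} (h : IsAdmAt 𝓔 X hij hjk)
    (hz : IsZero (X.obj (Wedge.mk j j le_rfl))) : IsCocartesianAt X hij le_rfl hjk := by
  obtain ⟨w, hw⟩ := h
  exact (isPushout_iff_isCokernel hz).2 ⟨w, 𝓔.isCokernel _ hw⟩

theorem IsAdmAt.of_isCocartesianAt {hij : i ≤ j} {hjk : j ≤ k}
    (hz : IsZero (X.obj (Wedge.mk j j le_rfl)))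
    (hm : IsAdmMono 𝓔.E (X.map (Wedge.hom hij (hij.trans hjk) le_rfl hjk)))
    (h : IsCocartesianAt X hij le_rfl hjk) : IsAdmAt 𝓔 X hij hjk := by
  obtain ⟨w, ⟨hw⟩⟩ := (isPushout_iff_isCokernel hz).1 h
  exact ⟨w, 𝓔.mem_of_isCokernel w hm hw⟩

theorem IsAdmAt.of_isPullback {hij : i ≤ j} {hjk : j ≤ k}
    (hz : IsZero (X.obj (Wedge.mk j j le_rfl)))
    (he : IsAdmEpi 𝓔.E (X.map (Wedge.hom (hij.trans hjk) hjk hij le_rfl)))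
    (h : IsPullback (X.map (Wedge.hom hij (hij.trans hjk) le_rfl hjk))
      (X.map (Wedge.hom hij le_rfl hij le_rfl))
      (X.map (Wedge.hom (hij.trans hjk) hjk hij le_rfl))
      (X.map (Wedge.hom le_rfl hjk le_rfl hjk))) : IsAdmAt 𝓔 X hij hjk := by
  obtain ⟨w, ⟨hw⟩⟩ := (isPullback_iff_isKernel hz).1 h
  exact ⟨w, 𝓔.mem_of_isKernel w he hw⟩

theorem IsAdmAt.isCocartesianAt {hij : i ≤ j} {hjk : j ≤ k} {hkl : k ≤ l}
    (hz : IsZero (X.obj (Wedge.mk j j le_rfl))) (h : IsAdmAt 𝓔 X hij hjk)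
    (h' : IsAdmAt 𝓔 X hij (hjk.trans hkl)) : IsCocartesianAt X hij hjk hkl :=
  IsPushout.of_left (h₁₁ := X.map (Wedge.hom hij (hij.trans hjk) le_rfl hjk))
    (h₂₁ := X.map (Wedge.hom le_rfl hjk le_rfl hjk))
    (by rw [← X.map_comp, ← X.map_comp]; exact h'.isCocartesianAt_diag hz) (wedge_comp X _ _ _ _)
    (h.isCocartesianAt_diag hz)

theorem isAdm.isZero_diag (hX : isAdm 𝓔 X) (i : ℤ) : IsZero (X.obj (Wedge.mk i i le_rfl)) := by
  obtain ⟨w, -⟩ := hX i i i le_rfl le_rfl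
  rw [← X.map_comp] at w
  exact (IsZero.iff_id_eq_zero _).2 ((X.map_id _).symm.trans w)

end AdmissibleAt

section WedgePro

variable {A : Type u} [Category.{v} A]

variable (A) in
/-- The ind-systems of pro-objects `j ↦ "lim"_{i ≤ j} X_{i,j}` whose formal colimits are the values
of `wedgeLim`. -/
def wedgePro : (Wedge ⥤ A) ⥤ ℤ ⥤ Pro A :=
  extend ⋙ (Functor.whiskeringRight _ _ _).obj (proLim ℤᵒᵈ)

/-- The structure maps of the ind-object `wedgeLim.obj X`. -/
def wedgeι (X : Wedge ⥤ A) (j : ℤ) :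
    Ind.yoneda.obj (((wedgePro A).obj X).obj j) ⟶ wedgeLim.obj X :=
  indι ((wedgePro A).obj X) j

theorem wedgeι_w (X : Wedge ⥤ A) {j j' : ℤ} (h : j ≤ j') :
    Ind.yoneda.map (((wedgePro A).obj X).map (homOfLE h)) ≫ wedgeι X j' = wedgeι X j :=
  indι_w _ _

theorem wedgeι_map {X Y : Wedge ⥤ A} (g : X ⟶ Y) (j : ℤ) :
    wedgeι X j ≫ wedgeLim.map g = Ind.yoneda.map (((wedgePro A).map g).app j) ≫ wedgeι Y j :=
  indι_map ((wedgePro A).map g) j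

theorem wedgeLim_hom_ext {X : Wedge ⥤ A} {P : Ind (Pro A)} {f g : wedgeLim.obj X ⟶ P}
    (h : ∀ j, wedgeι X j ≫ f = wedgeι X j ≫ g) : f = g :=
  indLim_hom_ext h

/-- The projection `"lim"_{i ≤ j} X_{i,j} ⟶ X_{i,j}`, continued by the one to `X_{j,j}`. -/
def wedgeπMin (X : Wedge ⥤ A) (i j : ℤ) :
    ((wedgePro A).obj X).obj j ⟶
      (proConst A).obj (X.obj (Wedge.mk (min i j) j (min_le_right i j))) :=
  proπ ((extend.obj X).obj j) (OrderDual.toDual i)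

theorem wedgeπMin_w (X : Wedge ⥤ A) {i i' : ℤ} (h : i ≤ i') (j : ℤ) :
    wedgeπMin X i j ≫ (proConst A).map (X.map (Wedge.hom (min_le_right i j) (min_le_right i' j)
      (min_le_min h le_rfl) le_rfl)) = wedgeπMin X i' j :=
  proπ_w ((extend.obj X).obj j) (i := OrderDual.toDual i') (i' := OrderDual.toDual i) (homOfLE h)

theorem wedgePro_map_πMin (X : Wedge ⥤ A) (i : ℤ) {j j' : ℤ} (h : j ≤ j') :
    ((wedgePro A).obj X).map (homOfLE h) ≫ wedgeπMin X i j' =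
      wedgeπMin X i j ≫ (proConst A).map (X.map (Wedge.hom (min_le_right i j)
        (min_le_right i j') (min_le_min le_rfl h) h)) :=
  proLim_map_π ((extend.obj X).map (homOfLE h)) (OrderDual.toDual i)

theorem wedgePro_map_app_πMin {X Y : Wedge ⥤ A} (g : X ⟶ Y) (i j : ℤ) :
    ((wedgePro A).map g).app j ≫ wedgeπMin Y i j =
      wedgeπMin X i j ≫ (proConst A).map (g.app (Wedge.mk (min i j) j (min_le_right i j))) :=
  proLim_map_π ((extend.map g).app j) (OrderDual.toDual i)

theorem wedgePro_hom_ext_min {X : Wedge ⥤ A} {j : ℤ} {P : Pro A}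
    {f g : P ⟶ ((wedgePro A).obj X).obj j}
    (h : ∀ i : ℤ, f ≫ wedgeπMin X i j = g ≫ wedgeπMin X i j) : f = g :=
  proLim_hom_ext fun i => h (OrderDual.ofDual i)

theorem exists_factor_wedgeπMin (X : Wedge ⥤ A) {j : ℤ} {a : A}
    (f : ((wedgePro A).obj X).obj j ⟶ (proConst A).obj a) :
    ∃ (i : ℤ) (g : X.obj (Wedge.mk (min i j) j (min_le_right i j)) ⟶ a),
      wedgeπMin X i j ≫ (proConst A).map g = f :=
  exists_factor_proπ ((extend.obj X).obj j) f

theorem exists_eq_of_wedgeπMin_eq (X : Wedge ⥤ A) {i j : ℤ} {a : A}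
    (f g : X.obj (Wedge.mk (min i j) j (min_le_right i j)) ⟶ a)
    (h : wedgeπMin X i j ≫ (proConst A).map f = wedgeπMin X i j ≫ (proConst A).map g) :
    ∃ (i' : ℤ) (hi : i' ≤ i),
      X.map (Wedge.hom (min_le_right i' j) (min_le_right i j) (min_le_min hi le_rfl) le_rfl) ≫ f =
        X.map (Wedge.hom (min_le_right i' j) (min_le_right i j) (min_le_min hi le_rfl) le_rfl) ≫
          g := by
  obtain ⟨i', t, ht⟩ := exists_eq_of_proπ_eq ((extend.obj X).obj j) f g h
  exact ⟨OrderDual.ofDual i', t.le, ht⟩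

theorem exists_wedgePro_lift_min (X : Wedge ⥤ A) {j : ℤ} {P : Pro A}
    (f : ∀ i : ℤ, P ⟶ (proConst A).obj (X.obj (Wedge.mk (min i j) j (min_le_right i j))))
    (hf : ∀ (i i' : ℤ) (h : i ≤ i'),
      f i ≫ (proConst A).map (X.map (Wedge.hom (min_le_right i j) (min_le_right i' j)
        (min_le_min h le_rfl) le_rfl)) = f i') :
    ∃ g : P ⟶ ((wedgePro A).obj X).obj j, ∀ i : ℤ, g ≫ wedgeπMin X i j = f i :=
  let c : Cone ((extend.obj X).obj j ⋙ proConst A) :=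
    { pt := P
      π :=
        { app := fun i => f (OrderDual.ofDual i.unop)
          naturality := fun _ _ t => (Category.id_comp _).trans (hf _ _ t.unop.le).symm } }
  ⟨limit.lift _ c, fun i => limit.lift_π c (op (OrderDual.toDual i))⟩

/-- The projection `"lim"_{i ≤ j} X_{i,j} ⟶ X_{i,j}`. -/
def wedgeπ (X : Wedge ⥤ A) {i j : ℤ} (h : i ≤ j) :
    ((wedgePro A).obj X).obj j ⟶ (proConst A).obj (X.obj (Wedge.mk i j h)) :=
  wedgeπMin X i j ≫
    (proConst A).map (X.map (Wedge.hom (min_le_right i j) h (min_le_left i j) le_rfl))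

theorem wedge_map_comp (X : Wedge ⥤ A) {p q r : Wedge} (f : p ⟶ q) (g : q ⟶ r) (h : p ⟶ r) :
    X.map f ≫ X.map g = X.map h :=
  (X.map_comp f g).symm

theorem wedgeπMin_eq (X : Wedge ⥤ A) (i j : ℤ) :
    wedgeπMin X i j = wedgeπ X (min_le_right i j) := by
  rw [wedgeπ, ← wedgeπMin_w X (min_le_left i j) j]

theorem wedgeπ_map (X : Wedge ⥤ A) {i j i' j' : ℤ} (h : i ≤ j) (h' : i' ≤ j') (hi : i ≤ i')
    (hj : j ≤ j') :
    wedgeπ X h ≫ (proConst A).map (X.map (Wedge.hom h h' hi hj)) =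
      ((wedgePro A).obj X).map (homOfLE hj) ≫ wedgeπ X h' := by
  rw [wedgeπ, wedgeπ, reassoc_of% wedgePro_map_πMin, ← wedgeπMin_w X hi j, Category.assoc,
    Category.assoc]
  simp only [← Functor.map_comp]
  rfl

theorem wedgeπ_w (X : Wedge ⥤ A) {i i' j : ℤ} (hi : i ≤ i') (h' : i' ≤ j) :
    wedgeπ X (hi.trans h') ≫
      (proConst A).map (X.map (Wedge.hom (hi.trans h') h' hi le_rfl)) = wedgeπ X h' := by
  rw [wedgeπ_map]
  exact (congrArg (· ≫ _) (CategoryTheory.Functor.map_id _ j)).trans (Category.id_comp _)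

theorem wedgePro_map_app_π {X Y : Wedge ⥤ A} (g : X ⟶ Y) {i j : ℤ} (h : i ≤ j) :
    ((wedgePro A).map g).app j ≫ wedgeπ Y h =
      wedgeπ X h ≫ (proConst A).map (g.app (Wedge.mk i j h)) := by
  rw [wedgeπ, wedgeπ, reassoc_of% wedgePro_map_app_πMin, Category.assoc, ← Functor.map_comp,
    ← Functor.map_comp, g.naturality]

theorem wedgePro_hom_ext {X : Wedge ⥤ A} {b j : ℤ} (hb : b ≤ j) {P : Pro A}
    {f g : P ⟶ ((wedgePro A).obj X).obj j}
    (h : ∀ (i : ℤ) (hi : i ≤ b), f ≫ wedgeπ X (hi.trans hb) = g ≫ wedgeπ X (hi.trans hb)) :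
    f = g := by
  apply wedgePro_hom_ext_min
  intro i
  have e : min i b ≤ min i j := min_le_min le_rfl hb
  rw [wedgeπMin_eq, ← wedgeπ_w X e (min_le_right i j), reassoc_of% h _ (min_le_right i b)]

theorem exists_wedgePro_lift (X : Wedge ⥤ A) {b j : ℤ} (hb : b ≤ j) {P : Pro A}
    (f : ∀ (i : ℤ) (hi : i ≤ b), P ⟶ (proConst A).obj (X.obj (Wedge.mk i j (hi.trans hb))))
    (hf : ∀ (i i' : ℤ) (h : i ≤ i') (hi' : i' ≤ b),
      f i (h.trans hi') ≫ (proConst A).map (X.map (Wedge.hom _ _ h le_rfl)) = f i' hi') :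
    ∃ g : P ⟶ ((wedgePro A).obj X).obj j,
      ∀ (i : ℤ) (hi : i ≤ b), g ≫ wedgeπ X (hi.trans hb) = f i hi := by
  obtain ⟨g, hg⟩ := exists_wedgePro_lift_min X (j := j)
    (fun i => f (min i b) (min_le_right i b) ≫ (proConst A).map (X.map (Wedge.hom
      ((min_le_right i b).trans hb) (min_le_right i j) (min_le_min le_rfl hb) le_rfl)))
    (fun i i' h => by
      rw [← hf _ _ (min_le_min h le_rfl) (min_le_right i' b), Category.assoc, Category.assoc]
      simp only [← Functor.map_comp]
      rfl)
  refine ⟨g, fun i hi => ?_⟩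
  rw [wedgeπ, reassoc_of% hg i, ← Functor.map_comp,
    wedge_map_comp X _ _ (Wedge.hom _ _ (min_le_left i b) le_rfl)]
  exact hf (min i b) i _ hi

theorem exists_factor_wedgeπ (X : Wedge ⥤ A) {j : ℤ} (b : ℤ) {a : A}
    (f : ((wedgePro A).obj X).obj j ⟶ (proConst A).obj a) :
    ∃ (i : ℤ) (hi : i ≤ j) (_ : i ≤ b) (g : X.obj (Wedge.mk i j hi) ⟶ a),
      wedgeπ X hi ≫ (proConst A).map g = f := by
  obtain ⟨i, g, rfl⟩ := exists_factor_wedgeπMin X f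
  have e : min (min i j) b ≤ min i j := min_le_left _ _
  refine ⟨min (min i j) b, e.trans (min_le_right i j), min_le_right _ _,
    X.map (Wedge.hom _ (min_le_right i j) e le_rfl) ≫ g, ?_⟩
  rw [Functor.map_comp, reassoc_of% wedgeπ_w X e (min_le_right i j), wedgeπMin_eq]

end WedgePro

section AdmissibleWedgePro

variable {A : Type u} [Category.{v} A] [Preadditive A] [HasZeroObject A]
  [HasBinaryBiproducts A] {𝓔 : ExactStructure A} {X Y : Wedge ⥤ A}

theorem isAdm.wedgeπ_cancel (hX : isAdm 𝓔 X) {i j : ℤ} (h : i ≤ j) {a : A}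
    {f g : X.obj (Wedge.mk i j h) ⟶ a}
    (e : wedgeπ X h ≫ (proConst A).map f = wedgeπ X h ≫ (proConst A).map g) : f = g := by
  rw [wedgeπ, Category.assoc, Category.assoc, ← Functor.map_comp, ← Functor.map_comp] at e
  obtain ⟨i', hi, e⟩ := exists_eq_of_wedgeπMin_eq X _ _ e
  have hi' : min i' j ≤ i := (min_le_left i' j).trans hi
  have := (hX.admEpi hi' h).epi
  rw [← cancel_epi (X.map (Wedge.hom (hi'.trans h) h hi' le_rfl))]
  exact (X.map_comp_assoc _ _ f).trans (e.trans (X.map_comp_assoc _ _ g).symm)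

theorem isAdm.isPullback_wedgePro (hX : isAdm 𝓔 X) {i j k : ℤ} (hij : i ≤ j) (hjk : j ≤ k) :
    IsPullback (((wedgePro A).obj X).map (homOfLE hjk)) (wedgeπ X hij) (wedgeπ X (hij.trans hjk))
      ((proConst A).map (X.map (Wedge.hom hij (hij.trans hjk) le_rfl hjk))) := by
  have sq (i' : ℤ) (hi : i' ≤ i) := (hX.isPullback hi hij hjk).map (proConst A)
  have exists_lift (s : PullbackCone (wedgeπ X (hij.trans hjk))
      ((proConst A).map (X.map (Wedge.hom hij (hij.trans hjk) le_rfl hjk)))) :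
      ∃ g, g ≫ ((wedgePro A).obj X).map (homOfLE hjk) = s.fst ∧ g ≫ wedgeπ X hij = s.snd := by
    obtain ⟨g, hg⟩ := exists_wedgePro_lift X hij
      (fun i' hi => (sq i' hi).lift (s.fst ≫ wedgeπ X (hi.trans (hij.trans hjk))) s.snd
        (by rw [Category.assoc, wedgeπ_w, s.condition]))
      (fun i' i'' hi hi' => (sq i'' hi').hom_ext
        (by
          rw [IsPullback.lift_fst, Category.assoc, ← Functor.map_comp, wedge_comp X _ _
            (Wedge.hom (hi.trans (hi'.trans hij)) (hi.trans (hi'.trans (hij.trans hjk))) le_rfl hjk)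
            (Wedge.hom _ _ hi le_rfl), Functor.map_comp, IsPullback.lift_fst_assoc, Category.assoc,
            wedgeπ_w])
        (by
          rw [IsPullback.lift_snd, Category.assoc, ← Functor.map_comp, ← X.map_comp]
          exact (sq i' _).lift_snd _ _ _))
    refine ⟨g, wedgePro_hom_ext (hij.trans hjk) fun i' hi => ?_, ?_⟩
    · rw [Category.assoc, ← wedgeπ_map X (hi.trans hij) _ le_rfl, reassoc_of% hg i' hi,
        IsPullback.lift_fst]
    · rw [← wedgeπ_w X le_rfl hij, reassoc_of% hg i le_rfl, IsPullback.lift_snd]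
  choose lift lift_fst lift_snd using exists_lift
  refine ⟨⟨(wedgeπ_map X _ _ _ _).symm⟩,
    ⟨PullbackCone.IsLimit.mk _ lift lift_fst lift_snd fun s m h₁ h₂ => ?_⟩⟩
  refine wedgePro_hom_ext hij fun i' hi => (sq i' hi).hom_ext ?_ ?_
  · rw [Category.assoc, Category.assoc, wedgeπ_map, reassoc_of% h₁, reassoc_of% lift_fst]
  · rw [Category.assoc, Category.assoc, wedgeπ_w, h₂, lift_snd]

theorem isAdm.mono_wedgePro_map (hX : isAdm 𝓔 X) {j k : ℤ} (h : j ≤ k) :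
    Mono (((wedgePro A).obj X).map (homOfLE h)) :=
  have := (hX.admMono le_rfl h).mono
  (hX.isPullback_wedgePro le_rfl h).mono_fst_of_mono

theorem isAdm.wedgeι_cancel (hX : isAdm 𝓔 X) {P : Pro A} {j : ℤ}
    {f g : P ⟶ ((wedgePro A).obj X).obj j}
    (h : Ind.yoneda.map f ≫ wedgeι X j = Ind.yoneda.map g ≫ wedgeι X j) : f = g := by
  obtain ⟨k, t, ht⟩ := exists_eq_of_indι_eq _ _ _ h
  have : Mono (((wedgePro A).obj X).map t) := hX.mono_wedgePro_map t.le
  exact (cancel_mono _).1 ht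

theorem isAdm.exists_desc (hX : isAdm 𝓔 X) {i j : ℤ} (hij : i ≤ j) {a : A}
    (u : ((wedgePro A).obj X).obj j ⟶ (proConst A).obj a) (z : X.obj (Wedge.mk i i le_rfl) ⟶ a)
    (h : ((wedgePro A).obj X).map (homOfLE hij) ≫ u = wedgeπ X le_rfl ≫ (proConst A).map z) :
    ∃ g : X.obj (Wedge.mk i j hij) ⟶ a, wedgeπ X hij ≫ (proConst A).map g = u := by
  obtain ⟨i', _, hi, u, rfl⟩ := exists_factor_wedgeπ X i u
  have sq : IsCocartesianAt X hi le_rfl hij :=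
    IsAdmAt.isCocartesianAt_diag (hX _ _ _ hi hij) (hX.isZero_diag i)
  refine ⟨sq.desc u z (hX.wedgeπ_cancel hi ?_), ?_⟩
  · rw [Functor.map_comp, Functor.map_comp, reassoc_of% wedgeπ_map X, h, reassoc_of% wedgeπ_w X]
  · rw [← wedgeπ_w X hi hij, Category.assoc, ← Functor.map_comp, sq.inl_desc]

theorem isAdm.wedgePro_map_injective (hX : isAdm 𝓔 X) {f g : X ⟶ Y}
    (h : (wedgePro A).map f = (wedgePro A).map g) : f = g := by
  ext ⟨⟨i, j⟩, hij⟩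
  refine hX.wedgeπ_cancel hij ?_
  rw [← wedgePro_map_app_π, ← wedgePro_map_app_π, h]

theorem isAdm.exists_app (hX : isAdm 𝓔 X) (hY : isAdm 𝓔 Y)
    (h : (wedgePro A).obj X ⟶ (wedgePro A).obj Y) {i j : ℤ} (hij : i ≤ j) :
    ∃ g : X.obj (Wedge.mk i j hij) ⟶ Y.obj (Wedge.mk i j hij),
      wedgeπ X hij ≫ (proConst A).map g = h.app j ≫ wedgeπ Y hij := by
  have hz := (hY.isZero_diag i).isTerminal.isTerminalObj (proConst A)
  refine hX.exists_desc hij _ (0 ≫ Y.map (Wedge.hom le_rfl hij le_rfl hij)) ?_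
  rw [h.naturality_assoc, ← wedgeπ_map Y le_rfl, Functor.map_comp, ← Category.assoc,
    ← Category.assoc]
  exact congrArg (· ≫ _) (hz.hom_ext _ _)

theorem isAdm.wedgePro_map_surjective (hX : isAdm 𝓔 X) (hY : isAdm 𝓔 Y)
    (h : (wedgePro A).obj X ⟶ (wedgePro A).obj Y) : ∃ g : X ⟶ Y, (wedgePro A).map g = h := by
  choose g hg using @isAdm.exists_app _ _ _ _ _ _ _ _ hX hY h
  have naturality {i j i' j' : ℤ} (hij : i ≤ j) (hij' : i' ≤ j') (hi : i ≤ i') (hj : j ≤ j') :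
      X.map (Wedge.hom hij hij' hi hj) ≫ g hij' = g hij ≫ Y.map (Wedge.hom hij hij' hi hj) := by
    refine hX.wedgeπ_cancel hij ?_
    rw [Functor.map_comp, Functor.map_comp, reassoc_of% wedgeπ_map X, hg, reassoc_of% hg,
      wedgeπ_map Y, h.naturality_assoc]
  refine ⟨⟨fun p => g p.property, fun p q t => naturality p.property q.property t.le.1 t.le.2⟩, ?_⟩
  ext j
  refine wedgePro_hom_ext le_rfl fun i hi => ?_
  rw [wedgePro_map_app_π, ← hg]

theorem isAdm.wedgeLim_map_injective (hX : isAdm 𝓔 X) (hY : isAdm 𝓔 Y) {f g : X ⟶ Y}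
    (h : wedgeLim.map f = wedgeLim.map g) : f = g := by
  refine hX.wedgePro_map_injective ?_
  ext j
  refine hY.wedgeι_cancel ?_
  rw [← wedgeι_map, ← wedgeι_map, h]

end AdmissibleWedgePro

section Bicofinal

theorem Bicofinal.exists_above_of_rel {R : ℤ → ℤ → Prop}
    (hR : ∀ {n n' l l' : ℤ}, n' ≤ n → l ≤ l' → R n l → R n' l') (exists_right : ∀ n, ∃ l, R n l)
    (exists_left : ∀ l, ∃ n, R n l) :
    ∃ φ : Bicofinal, (∀ n, n ≤ φ.toFun n) ∧ ∀ n, R n (φ.toFun n) := by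
  have exists_least (n : ℤ) : ∃ l, (n ≤ l ∧ R n l) ∧ ∀ l', (n ≤ l' ∧ R n l') → l ≤ l' := by
    obtain ⟨l, hl⟩ := exists_right n
    exact Int.exists_least_of_bdd ⟨n, fun _ h => h.1⟩
      ⟨max n l, le_max_left n l, hR le_rfl (le_max_right n l) hl⟩
  choose φ hφ φ_le using exists_least
  refine ⟨⟨φ, fun n n' h => φ_le n _ ⟨h.trans (hφ n').1, hR h le_rfl (hφ n').2⟩,
    Filter.tendsto_atTop_mono (fun n => (hφ n).1) Filter.tendsto_id,
    Filter.tendsto_atBot.2 fun l => ?_⟩, fun n => (hφ n).1, fun n => (hφ n).2⟩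
  obtain ⟨n, hn⟩ := exists_left l
  filter_upwards [Filter.eventually_le_atBot n, Filter.eventually_le_atBot l] with m hmn hml
  exact φ_le m l ⟨hml, hR hmn le_rfl hn⟩

/-- The identity of `ℤ` as a bicofinal map. -/
def Bicofinal.refl : Bicofinal :=
  ⟨id, monotone_id, Filter.tendsto_id, Filter.tendsto_id⟩

end Bicofinal

section Fractions

variable {A : Type u} [Category.{v} A]

/-- The canonical map `Y ⟶ Y ∘ φ̃` for `φ` above the identity. -/
def toTilde (Y : Wedge ⥤ A) (φ : Bicofinal) (h : ∀ n, n ≤ φ.toFun n) : Y ⟶ φ.tilde ⋙ Y where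
  app p := Y.map (Wedge.hom p.2 (φ.mono p.2) (h p.1.1) (h p.1.2))
  naturality _ _ _ := wedge_comp Y _ _ _ _

/-- The canonical map `"lim"_{i ≤ φ j} Y_{i,φ j} ⟶ "lim"_{i ≤ j} Y_{φ i,φ j}`. -/
def wedgeProTilde (φ : Bicofinal) (Y : Wedge ⥤ A) (j : ℤ) :
    ((wedgePro A).obj Y).obj (φ.toFun j) ⟶ ((wedgePro A).obj (φ.tilde ⋙ Y)).obj j :=
  (tildeSystem φ Y).hom.app j

theorem wedgeProTilde_naturality (φ : Bicofinal) (Y : Wedge ⥤ A) {j j' : ℤ} (h : j ≤ j') :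
    ((wedgePro A).obj Y).map (homOfLE (φ.mono h)) ≫ wedgeProTilde φ Y j' =
      wedgeProTilde φ Y j ≫ ((wedgePro A).obj (φ.tilde ⋙ Y)).map (homOfLE h) :=
  (tildeSystem φ Y).hom.naturality (homOfLE h)

theorem wedgeProTilde_π (φ : Bicofinal) (Y : Wedge ⥤ A) {i j : ℤ} (h : i ≤ j) :
    wedgeProTilde φ Y j ≫ wedgeπ (φ.tilde ⋙ Y) h = wedgeπ Y (φ.mono h) := by
  have e : wedgeProTilde φ Y j ≫ wedgeπMin (φ.tilde ⋙ Y) i j =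
      wedgeπMin Y (φ.toFun i) (φ.toFun j) ≫ (proConst A).map (Y.map (Wedge.hom
        (min_le_right _ _) (φ.mono (min_le_right i j)) φ.mono.map_min.ge le_rfl)) :=
    tildeSystem_π φ Y j (OrderDual.toDual i)
  refine ((Category.assoc _ _ _).symm.trans (congrArg (· ≫ _) e)).trans ?_
  refine (Category.assoc _ _ _).trans (congrArg (wedgeπMin Y _ _ ≫ ·) ?_)
  exact ((proConst A).map_comp _ _).symm.trans
    (congrArg (proConst A).map (wedge_map_comp Y _ _ _))

theorem wedgeProTilde_ι (φ : Bicofinal) (h : ∀ n, n ≤ φ.toFun n) (Y : Wedge ⥤ A) (j : ℤ) :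
    Ind.yoneda.map (wedgeProTilde φ Y j) ≫ wedgeι (φ.tilde ⋙ Y) j =
      wedgeι Y (φ.toFun j) ≫ wedgeLim.map (toTilde Y φ h) := by
  rw [wedgeι_map, ← wedgeι_w (φ.tilde ⋙ Y) (h j), ← Functor.map_comp_assoc]
  congr 2
  refine wedgePro_hom_ext (h j) fun i hi => ?_
  rw [wedgePro_map_app_π, Category.assoc, ← wedgeπ_map (φ.tilde ⋙ Y) hi (hi.trans (h j)) le_rfl]
  refine ((reassoc_of% wedgeProTilde_π φ Y hi) _).trans ?_
  exact (wedgeπ_map Y (φ.mono hi) (φ.mono (hi.trans (h j))) le_rfl (φ.mono (h j))).trans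
    (wedgeπ_map Y (hi.trans (h j)) (φ.mono (hi.trans (h j))) (h i) (φ.mono (h j))).symm

/-- `f` carries the `n`-th step of the ind-object `wedgeLim.obj X` into the `l`-th step of
`wedgeLim.obj Y`. -/
def MapsInto {X Y : Wedge ⥤ A} (f : wedgeLim.obj X ⟶ wedgeLim.obj Y) (n l : ℤ) : Prop :=
  ∃ t : ((wedgePro A).obj X).obj n ⟶ ((wedgePro A).obj Y).obj l,
    Ind.yoneda.map t ≫ wedgeι Y l = wedgeι X n ≫ f

theorem MapsInto.mono {X Y : Wedge ⥤ A} {f : wedgeLim.obj X ⟶ wedgeLim.obj Y} {n n' l l' : ℤ}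
    (hn : n' ≤ n) (hl : l ≤ l') (h : MapsInto f n l) : MapsInto f n' l' := by
  obtain ⟨t, ht⟩ := h
  refine ⟨((wedgePro A).obj X).map (homOfLE hn) ≫ t ≫ ((wedgePro A).obj Y).map (homOfLE hl), ?_⟩
  rw [Functor.map_comp, Functor.map_comp, Category.assoc, Category.assoc, wedgeι_w, ht,
    reassoc_of% wedgeι_w X hn]

theorem exists_mapsInto {X Y : Wedge ⥤ A} (f : wedgeLim.obj X ⟶ wedgeLim.obj Y) (n : ℤ) :
    ∃ l, MapsInto f n l :=
  exists_factor_indι _ (wedgeι X n ≫ f)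

variable [Preadditive A] [HasZeroObject A] [HasBinaryBiproducts A] {𝓔 : ExactStructure A}
  {X Y : Wedge ⥤ A}

/-- A map from a step of `X` to `Y_{k,l}` factors through some `X_{i,n}`, hence vanishes on the
`i`-th step of `X`, which therefore lands in the kernel of the map to `Y_{k,l}`. -/
theorem isAdm.exists_mapsInto (hX : isAdm 𝓔 X) (hY : isAdm 𝓔 Y)
    (f : wedgeLim.obj X ⟶ wedgeLim.obj Y) (k : ℤ) : ∃ i, MapsInto f i k := by
  obtain ⟨l, hl⟩ := LocCompact.exists_mapsInto f k
  obtain ⟨t, ht⟩ := hl.mono le_rfl (le_max_right k l)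
  have hkl := le_max_left k l
  obtain ⟨i, hi, -, g, hg⟩ := exists_factor_wedgeπ X k (t ≫ wedgeπ Y hkl)
  have vanish : (((wedgePro A).obj X).map (homOfLE hi) ≫ t) ≫ wedgeπ Y hkl =
      (wedgeπ X le_rfl ≫ (proConst A).map 0) ≫
        (proConst A).map (Y.map (Wedge.hom le_rfl hkl le_rfl hkl)) := by
    rw [Category.assoc, Category.assoc, ← hg, ← Functor.map_comp,
      ← reassoc_of% wedgeπ_map X le_rfl hi le_rfl hi, ← Functor.map_comp]
    exact congrArg (fun s => wedgeπ X le_rfl ≫ (proConst A).map s)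
      ((hX.isZero_diag i).eq_of_src _ _)
  have sq := hY.isPullback_wedgePro le_rfl hkl
  refine ⟨i, sq.lift _ _ vanish, ?_⟩
  rw [← wedgeι_w Y hkl, ← Functor.map_comp_assoc, sq.lift_fst, Functor.map_comp, Category.assoc,
    ht, reassoc_of% wedgeι_w X hi]

theorem isAdm.exists_fraction (hX : isAdm 𝓔 X) (hY : isAdm 𝓔 Y)
    (f : wedgeLim.obj X ⟶ wedgeLim.obj Y) :
    ∃ (φ : Bicofinal) (hφ : ∀ n, n ≤ φ.toFun n) (g : X ⟶ φ.tilde ⋙ Y),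
      wedgeLim.map g = f ≫ wedgeLim.map (toTilde Y φ hφ) := by
  obtain ⟨φ, hφ, hf⟩ := Bicofinal.exists_above_of_rel MapsInto.mono
    (LocCompact.exists_mapsInto f) (hX.exists_mapsInto hY f)
  choose t ht using hf
  have naturality {n n' : ℤ} (h : n ≤ n') :
      ((wedgePro A).obj X).map (homOfLE h) ≫ t n' =
        t n ≫ ((wedgePro A).obj Y).map (homOfLE (φ.mono h)) := by
    refine hY.wedgeι_cancel ?_
    rw [Functor.map_comp, Functor.map_comp, Category.assoc, Category.assoc, wedgeι_w, ht, ht,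
      reassoc_of% wedgeι_w X h]
  let T : (wedgePro A).obj X ⟶ (wedgePro A).obj (φ.tilde ⋙ Y) :=
    { app := fun n => t n ≫ wedgeProTilde φ Y n
      naturality := fun n n' e => by
        rw [Category.assoc]
        exact ((reassoc_of% naturality e.le) _).trans
          (congrArg (t n ≫ ·) (wedgeProTilde_naturality φ Y e.le)) }
  obtain ⟨g, hg⟩ := hX.wedgePro_map_surjective (isAdm_tilde 𝓔 hY φ) T
  refine ⟨φ, hφ, g, wedgeLim_hom_ext fun j => ?_⟩
  rw [wedgeι_map, hg, ← reassoc_of% ht j, ← wedgeProTilde_ι, ← Functor.map_comp_assoc]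

end Fractions

section LeftFractions

variable {C D E : Type*} [Category* C] [Category* D] [Category* E] {F : C ⥤ D}
  {W : MorphismProperty C}

/-- Every map between values of `F` is `F.map g ≫ (F.map s)⁻¹` for maps `g` of `C` and `s` of `W`,
written without an inverse. -/
def HasLeftFractionPreimages (F : C ⥤ D) (W : MorphismProperty C) : Prop :=
  ∀ ⦃X Y : C⦄ (f : F.obj X ⟶ F.obj Y),
    ∃ (Z : C) (s : Y ⟶ Z) (g : X ⟶ Z), W s ∧ F.map g = f ≫ F.map s

theorem isLocalization_of_le (L : C ⥤ E) [L.IsLocalization W] {W' : MorphismProperty C}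
    (hW : W ≤ W') (hL : W'.IsInvertedBy L) : L.IsLocalization W' :=
  have : (𝟭 E).IsLocalization (W'.map L) :=
    Functor.IsLocalization.for_id _ ((MorphismProperty.map_le_iff W' _).2 hL)
  Functor.IsLocalization.comp L (𝟭 E) W (W'.map L) W' hL hW le_rfl

theorem HasLeftFractionPreimages.full {L : C ⥤ E} [L.IsLocalization W] {G : E ⥤ D}
    (h : HasLeftFractionPreimages (L ⋙ G) W) : G.Full := by
  have := Localization.essSurj L W
  refine G.full_of_comp_essSurj L fun X Y f => ?_
  obtain ⟨Z, s, g, hs, hg⟩ := h f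
  have := Localization.inverts L W s hs
  refine ⟨L.map g ≫ inv (L.map s), ?_⟩
  rw [G.map_comp, G.map_inv, IsIso.comp_inv_eq]
  exact hg

variable [F.Faithful]

theorem HasLeftFractionPreimages.exists_comp_mem (h : HasLeftFractionPreimages F W)
    (hF : W.IsInvertedBy F) {X Y : C} (f : X ⟶ Y) [IsIso (F.map f)] :
    ∃ (Z : C) (g : Y ⟶ Z), W (f ≫ g) ∧ IsIso (F.map g) := by
  obtain ⟨Z, s, g, hs, hg⟩ := h (inv (F.map f))
  have hfg : f ≫ g = s := F.map_injective (by rw [F.map_comp, hg, IsIso.hom_inv_id_assoc])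
  have := hF s hs
  exact ⟨Z, g, by rwa [hfg], by rw [hg]; infer_instance⟩

/-- A map `f` inverted by `F` has composites `f ≫ g` and `g ≫ g'` in `W`. -/
theorem HasLeftFractionPreimages.inverseImage_isInvertedBy (h : HasLeftFractionPreimages F W)
    (hF : W.IsInvertedBy F) {L : C ⥤ E} (hL : W.IsInvertedBy L) :
    ((MorphismProperty.isomorphisms D).inverseImage F).IsInvertedBy L := by
  intro X Y f (hf : IsIso (F.map f))
  obtain ⟨Z, g, hfg, hg⟩ := h.exists_comp_mem hF f
  obtain ⟨Z', g', hgg', -⟩ := h.exists_comp_mem hF g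
  have isIso_comp : IsIso (L.map f ≫ L.map g) := L.map_comp f g ▸ hL _ hfg
  have : IsIso (L.map g ≫ L.map g') := L.map_comp g g' ▸ hL _ hgg'
  have : Mono (L.map g) := mono_of_mono _ (L.map g')
  have : IsSplitEpi (L.map g) :=
    ⟨⟨inv (L.map f ≫ L.map g) ≫ L.map f, by rw [Category.assoc, IsIso.inv_hom_id]⟩⟩
  have := isIso_of_mono_of_isSplitEpi (L.map g)
  exact IsIso.of_isIso_comp_right _ (L.map g)

theorem HasLeftFractionPreimages.hasLeftCalculusOfFractions (h : HasLeftFractionPreimages F W)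
    (hF : W.IsInvertedBy F) :
    ((MorphismProperty.isomorphisms D).inverseImage F).HasLeftCalculusOfFractions where
  exists_leftFraction _ _ φ := by
    have : IsIso (F.map φ.s) := φ.hs
    obtain ⟨Z, s, g, hs, hg⟩ := h (inv (F.map φ.s) ≫ F.map φ.f)
    refine ⟨⟨g, s, hF s hs⟩, F.map_injective ?_⟩
    rw [F.map_comp, F.map_comp, hg, Category.assoc, IsIso.hom_inv_id_assoc]
  ext _ X Y f₁ f₂ s (hs : IsIso (F.map s)) hf :=
    ⟨Y, 𝟙 Y, MorphismProperty.id_mem _ Y, congrArg (· ≫ 𝟙 Y) <| F.map_injective <| by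
      rw [← cancel_epi (F.map s), ← F.map_comp, ← F.map_comp, hf]⟩

theorem HasLeftFractionPreimages.faithful {L : C ⥤ E} [L.IsLocalization W] {G : E ⥤ D}
    [(L ⋙ G).Faithful] (h : HasLeftFractionPreimages (L ⋙ G) W) : G.Faithful := by
  have hL := Localization.inverts L W
  have hF : W.IsInvertedBy (L ⋙ G) := .of_comp W L hL G
  have := h.hasLeftCalculusOfFractions hF
  have : L.IsLocalization ((MorphismProperty.isomorphisms D).inverseImage (L ⋙ G)) :=
    isLocalization_of_le L hF (h.inverseImage_isInvertedBy hF hL)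
  exact Functor.faithful_of_comp_of_hasLeftCalculusOfFractions L
    ((MorphismProperty.isomorphisms D).inverseImage (L ⋙ G)) G
    fun _ _ _ _ e => congrArg L.map ((L ⋙ G).map_injective e)

end LeftFractions

section FullyFaithful

variable {A : Type u} [Category.{v} A] [Preadditive A] [HasZeroObject A]
  [HasBinaryBiproducts A] {𝓔 : ExactStructure A}

instance : (biFunToKato 𝓔).Faithful where
  map_injective {X Y f g} h := by
    ext1
    exact X.property.wedgeLim_map_injective Y.property (congrArg (fun t => t.hom.hom) h)

theorem biFunToKato_hasLeftFractionPreimages :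
    HasLeftFractionPreimages (biFunToKato 𝓔) (Ua 𝓔) := by
  intro X Y f
  obtain ⟨φ, hφ, g, hg⟩ := X.property.exists_fraction Y.property f.hom.hom
  refine ⟨Y.precomp φ, ObjectProperty.homMk (toTilde Y.obj φ hφ), ObjectProperty.homMk g,
    Ua.mk Y Bicofinal.refl φ hφ, ?_⟩
  apply ObjectProperty.hom_ext
  apply ObjectProperty.hom_ext
  exact hg

theorem Q_comp_embedding : (Ua 𝓔).Q ⋙ embedding 𝓔 = biFunToKato 𝓔 :=
  Localization.Construction.fac _ _

instance : (embedding 𝓔).Full :=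
  HasLeftFractionPreimages.full (W := Ua 𝓔) (L := (Ua 𝓔).Q)
    (Q_comp_embedding (𝓔 := 𝓔) ▸ biFunToKato_hasLeftFractionPreimages)

instance : (embedding 𝓔).Faithful :=
  have : ((Ua 𝓔).Q ⋙ embedding 𝓔).Faithful := Q_comp_embedding (𝓔 := 𝓔) ▸ inferInstance
  HasLeftFractionPreimages.faithful (W := Ua 𝓔) (L := (Ua 𝓔).Q)
    (Q_comp_embedding (𝓔 := 𝓔) ▸ biFunToKato_hasLeftFractionPreimages)

end FullyFaithful

section KerCoker

variable {A : Type u} [Category.{v} A] [HasZeroMorphisms A]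

section Ker

theorem isPullback_kernelMap {a b a' b' : A} (f : a ⟶ b) (f' : a' ⟶ b') [HasKernel f]
    [HasKernel f'] (p : a ⟶ a') (q : b ⟶ b') [Mono q] (w : f ≫ q = p ≫ f') :
    IsPullback (kernel.map f f' p q w) (kernel.ι f) (kernel.ι f') p := by
  have h (s : PullbackCone (kernel.ι f') p) : s.snd ≫ f = 0 := by
    rw [← cancel_mono q, Category.assoc, w, ← reassoc_of% s.condition, kernel.condition,
      comp_zero, zero_comp]
  exact ⟨⟨kernel.lift_ι _ _ _⟩, ⟨PullbackCone.IsLimit.mk _ (fun s => kernel.lift f s.snd (h s))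
    (fun s => by
      rw [← cancel_mono (kernel.ι f'), Category.assoc, kernel.lift_ι, kernel.lift_ι_assoc,
        s.condition])
    (fun s => kernel.lift_ι _ _ _)
    (fun s m _ hm => by rw [← cancel_mono (kernel.ι f), kernel.lift_ι, hm])⟩⟩

variable {J : Type*} [Category* J] {S T : J ⥤ A} (α : S ⟶ T) [∀ p, HasKernel (α.app p)]

/-- The pointwise kernel of a natural transformation. -/
def kerFunctor : J ⥤ A where
  obj p := kernel (α.app p)
  map {p q} f := kernel.map (α.app p) (α.app q) (S.map f) (T.map f) (α.naturality f).symm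
  map_id p := by ext; simp
  map_comp f g := by ext; simp

/-- The inclusion of the pointwise kernel. -/
def kerFunctorι : kerFunctor α ⟶ S where
  app p := kernel.ι (α.app p)
  naturality p q f := by simp [kerFunctor]

theorem isZero_kerFunctor_obj (p : J) [Mono (α.app p)] : IsZero ((kerFunctor α).obj p) :=
  isZero_kernel_of_mono (α.app p)

theorem isIso_kerFunctorι_app {p : J} (hp : IsZero (T.obj p)) : IsIso ((kerFunctorι α).app p) :=
  kernel.ι_of_zero (hp.eq_zero_of_tgt (α.app p))

theorem isPullback_kerFunctor {p q : J} (f : p ⟶ q) [Mono (T.map f)] :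
    IsPullback ((kerFunctor α).map f) ((kerFunctorι α).app p) ((kerFunctorι α).app q)
      (S.map f) :=
  isPullback_kernelMap (α.app p) (α.app q) _ (T.map f) (α.naturality f).symm

end Ker

section Coker

theorem isPushout_cokernelMap {a b a' b' : A} (f : a ⟶ b) (f' : a' ⟶ b') [HasCokernel f]
    [HasCokernel f'] (p : a ⟶ a') [Epi p] (q : b ⟶ b') (w : f ≫ q = p ≫ f') :
    IsPushout q (cokernel.π f) (cokernel.π f') (cokernel.map f f' p q w) := by
  have h (s : PushoutCocone q (cokernel.π f)) : f' ≫ s.inl = 0 := by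
    rw [← cancel_epi p, ← reassoc_of% w, s.condition, cokernel.condition_assoc, comp_zero,
      zero_comp]
  exact ⟨⟨(cokernel.π_desc _ _ _).symm⟩, ⟨PushoutCocone.IsColimit.mk _
    (fun s => cokernel.desc f' s.inl (h s)) (fun s => cokernel.π_desc _ _ _)
    (fun s => by
      rw [← cancel_epi (cokernel.π f), cokernel.π_desc_assoc, Category.assoc, cokernel.π_desc,
        s.condition])
    (fun s m hm _ => by rw [← cancel_epi (cokernel.π f'), cokernel.π_desc, hm])⟩⟩

variable {J : Type*} [Category* J] {S T : J ⥤ A} (α : S ⟶ T) [∀ p, HasCokernel (α.app p)]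

/-- The pointwise cokernel of a natural transformation. -/
def cokerFunctor : J ⥤ A where
  obj p := cokernel (α.app p)
  map {p q} f := cokernel.map (α.app p) (α.app q) (S.map f) (T.map f) (α.naturality f).symm
  map_id p := by ext; simp
  map_comp f g := by ext; simp

/-- The projection to the pointwise cokernel. -/
def cokerFunctorπ : T ⟶ cokerFunctor α where
  app p := cokernel.π (α.app p)
  naturality p q f := by simp [cokerFunctor]

theorem isZero_cokerFunctor_obj (p : J) [Epi (α.app p)] : IsZero ((cokerFunctor α).obj p) :=
  isZero_cokernel_of_epi (α.app p)

theorem isIso_cokerFunctorπ_app {p : J} (hp : IsZero (S.obj p)) :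
    IsIso ((cokerFunctorπ α).app p) :=
  cokernel.π_of_zero (hp.eq_zero_of_src (α.app p))

theorem isPushout_cokerFunctor {p q : J} (f : p ⟶ q) [Epi (S.map f)] :
    IsPushout (T.map f) ((cokerFunctorπ α).app p) ((cokerFunctorπ α).app q)
      ((cokerFunctor α).map f) :=
  isPushout_cokernelMap (α.app p) (α.app q) (S.map f) _ (α.naturality f).symm

end Coker

end KerCoker

section DiagKer

variable {A : Type u} [Category.{v} A]

/-- The endofunctor `(i, j) ↦ (j, j)` of `Wedge`. -/
def wedgeDiag : Wedge ⥤ Wedge where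
  obj p := Wedge.mk p.1.2 p.1.2 le_rfl
  map f := Wedge.hom _ _ f.le.2 f.le.2
  map_id _ := Subsingleton.elim _ _
  map_comp _ _ := Subsingleton.elim _ _

/-- The transformation with components the maps `X_{i,j} ⟶ X_{j,j}`. -/
def diagHom (X : Wedge ⥤ A) : X ⟶ wedgeDiag ⋙ X where
  app p := X.map (Wedge.hom p.property le_rfl p.property le_rfl)
  naturality _ _ _ := wedge_comp X _ _ _ _

theorem isIso_wedge_map_self (X : Wedge ⥤ A) {p : Wedge} (f : p ⟶ p) : IsIso (X.map f) := by
  rw [Subsingleton.elim f (𝟙 p)]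
  infer_instance

section

variable [HasZeroMorphisms A] (V : Wedge ⥤ A) [∀ p, HasKernel ((diagHom V).app p)]

theorem isZero_ker_diagHom (j : ℤ) :
    IsZero ((kerFunctor (diagHom V)).obj (Wedge.mk j j le_rfl)) :=
  have : IsIso ((diagHom V).app (Wedge.mk j j le_rfl)) := isIso_wedge_map_self V _
  isZero_kerFunctor_obj _ _

theorem isPullback_ker_diagHom {i j k : ℤ} (hij : i ≤ j) (hjk : j ≤ k) :
    IsPullback ((kerFunctor (diagHom V)).map (Wedge.hom (hij.trans hjk) hjk hij le_rfl))
      ((kerFunctorι (diagHom V)).app (Wedge.mk i k (hij.trans hjk)))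
      ((kerFunctorι (diagHom V)).app (Wedge.mk j k hjk))
      (V.map (Wedge.hom (hij.trans hjk) hjk hij le_rfl)) :=
  have : IsIso ((wedgeDiag ⋙ V).map (Wedge.hom (hij.trans hjk) hjk hij le_rfl)) :=
    isIso_wedge_map_self V _
  isPullback_kerFunctor _ _

end

variable [Preadditive A] [HasZeroObject A] [HasBinaryBiproducts A]

/-- The properties of `(i, j) ↦ X_{-i-1,max(j,0)}`, continued by zero to `0 ≤ i`, for a bifunctor
`X : ℕᵒᵖ × ℕ ⥤ A` presenting an object of the admissible Kato category. -/
structure IsZeroContinuation (𝓔 : ExactStructure A) (V : Wedge ⥤ A) : Prop where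
  admEpi : ∀ {i i' j : ℤ} (hi : i ≤ i') (hij : i' ≤ j),
    IsAdmEpi 𝓔.E (V.map (Wedge.hom (hi.trans hij) hij hi le_rfl))
  admMono : ∀ {i j j' : ℤ} (hij : i ≤ j) (hj : j ≤ j'),
    IsAdmMono 𝓔.E (V.map (Wedge.hom hij (hij.trans hj) le_rfl hj))
  isPullback : ∀ {i i' j j' : ℤ} (hi : i ≤ i') (hij : i' ≤ j) (hj : j ≤ j') (_ : i' < 0),
    IsPullback (V.map (Wedge.hom (hi.trans hij) (hi.trans (hij.trans hj)) le_rfl hj))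
      (V.map (Wedge.hom (hi.trans hij) hij hi le_rfl))
      (V.map (Wedge.hom (hi.trans (hij.trans hj)) (hij.trans hj) hi le_rfl))
      (V.map (Wedge.hom hij (hij.trans hj) le_rfl hj))
  isZero : ∀ {i j : ℤ} (hij : i ≤ j), 0 ≤ i → IsZero (V.obj (Wedge.mk i j hij))

variable {𝓔 : ExactStructure A} {V : Wedge ⥤ A}

theorem IsZeroContinuation.hasKernel (hV : IsZeroContinuation 𝓔 V) (p : Wedge) :
    HasKernel ((diagHom V).app p) :=
  (hV.admEpi p.property le_rfl).hasKernel

variable [∀ p, HasKernel ((diagHom V).app p)]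

theorem IsZeroContinuation.isIso_kerFunctorι_app (hV : IsZeroContinuation 𝓔 V) (p : Wedge)
    (hp : 0 ≤ p.1.2) : IsIso ((kerFunctorι (diagHom V)).app p) :=
  LocCompact.isIso_kerFunctorι_app _ (hV.isZero le_rfl hp)

theorem IsZeroContinuation.isAdmAt_ker (hV : IsZeroContinuation 𝓔 V) {i j k : ℤ} (hij : i ≤ j)
    (hjk : j ≤ k) (hj : j < 0) : IsAdmAt 𝓔 (kerFunctor (diagHom V)) hij hjk := by
  have hk := isPullback_ker_diagHom V hij hjk
  refine .of_isPullback (isZero_ker_diagHom V j) ((hV.admEpi hij hjk).of_isPullback hk.flip) ?_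
  refine (IsPullback.of_right (h₁₂ := (kerFunctorι (diagHom V)).app _) ?_ (wedge_comp _ _ _ _ _)
    hk.flip)
  rw [(kerFunctorι (diagHom V)).naturality, (kerFunctorι (diagHom V)).naturality]
  exact (isPullback_ker_diagHom V hij le_rfl).flip.paste_horiz (hV.isPullback hij le_rfl hjk hj)

theorem IsZeroContinuation.admMono_ker (hV : IsZeroContinuation 𝓔 V) {i j k : ℤ} (hij : i ≤ j)
    (hjk : j ≤ k) : IsAdmMono 𝓔.E ((kerFunctor (diagHom V)).map
      (Wedge.hom hij (hij.trans hjk) le_rfl hjk)) := by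
  obtain hj | hj := lt_or_ge j 0
  · exact (hV.isAdmAt_ker hij hjk hj).admMono
  · have := hV.isIso_kerFunctorι_app (Wedge.mk i j hij) hj
    have := hV.isIso_kerFunctorι_app (Wedge.mk i k (hij.trans hjk)) (hj.trans hjk)
    refine (hV.admMono hij hjk).of_iso (asIso ((kerFunctorι (diagHom V)).app _)).symm
      (asIso ((kerFunctorι (diagHom V)).app _)).symm ?_
    rw [Iso.symm_hom, Iso.symm_hom, asIso_inv, asIso_inv, IsIso.comp_inv_eq, Category.assoc,
      (kerFunctorι (diagHom V)).naturality, IsIso.inv_hom_id_assoc]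

end DiagKer

section WedgeExt

variable {A : Type u} [Category.{v} A]

/-- The endofunctor `(i, j) ↦ (min i (-1), i)` of `Wedge`. -/
def wedgeLow : Wedge ⥤ Wedge where
  obj p := Wedge.mk (min p.1.1 (-1)) p.1.1 (min_le_left _ _)
  map f := Wedge.hom _ _ (min_le_min_right _ f.le.1) f.le.1
  map_id _ := Subsingleton.elim _ _
  map_comp _ _ := Subsingleton.elim _ _

/-- The endofunctor `(i, j) ↦ (min i (-1), j)` of `Wedge`. -/
def wedgeUp : Wedge ⥤ Wedge where
  obj p := Wedge.mk (min p.1.1 (-1)) p.1.2 (min_le_of_left_le p.property)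
  map f := Wedge.hom _ _ (min_le_min_right _ f.le.1) f.le.2
  map_id _ := Subsingleton.elim _ _
  map_comp _ _ := Subsingleton.elim _ _

/-- The transformation with components the maps `X_{min i (-1), i} ⟶ X_{min i (-1), j}`. -/
def lowUp (X : Wedge ⥤ A) : wedgeLow ⋙ X ⟶ wedgeUp ⋙ X where
  app p := X.map (Wedge.hom _ _ le_rfl p.property)
  naturality _ _ _ := wedge_comp X _ _ _ _

/-- The transformation with components the maps `X_{min i (-1), j} ⟶ X_{i,j}`. -/
def upHom (X : Wedge ⥤ A) : wedgeUp ⋙ X ⟶ X where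
  app _ := X.map (Wedge.hom _ _ (min_le_left _ _) le_rfl)
  naturality _ _ _ := wedge_comp X _ _ _ _

theorem isIso_upHom_app (X : Wedge ⥤ A) {p : Wedge} (hp : p.1.1 < 0) :
    IsIso ((upHom X).app p) := by
  let e : wedgeUp.obj p ≅ p :=
    ⟨Wedge.hom _ _ (min_le_left _ _) le_rfl,
      Wedge.hom _ _ (le_min le_rfl (Int.le_sub_one_of_lt hp)) le_rfl,
      Subsingleton.elim _ _, Subsingleton.elim _ _⟩
  exact inferInstanceAs (IsIso (X.mapIso e).hom)

section

variable [HasZeroMorphisms A] (K : Wedge ⥤ A) [∀ p, HasCokernel ((lowUp K).app p)]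

theorem isZero_coker_lowUp (j : ℤ) :
    IsZero ((cokerFunctor (lowUp K)).obj (Wedge.mk j j le_rfl)) :=
  have : IsIso ((lowUp K).app (Wedge.mk j j le_rfl)) := isIso_wedge_map_self K _
  isZero_cokerFunctor_obj _ _

theorem isPushout_coker_lowUp {i j k : ℤ} (hij : i ≤ j) (hjk : j ≤ k) :
    IsPushout ((wedgeUp ⋙ K).map (Wedge.hom hij (hij.trans hjk) le_rfl hjk))
      ((cokerFunctorπ (lowUp K)).app (Wedge.mk i j hij))
      ((cokerFunctorπ (lowUp K)).app (Wedge.mk i k (hij.trans hjk)))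
      ((cokerFunctor (lowUp K)).map (Wedge.hom hij (hij.trans hjk) le_rfl hjk)) :=
  have : IsIso ((wedgeLow ⋙ K).map (Wedge.hom hij (hij.trans hjk) le_rfl hjk)) :=
    isIso_wedge_map_self K _
  isPushout_cokerFunctor _ _

end

variable [Preadditive A] [HasZeroObject A] [HasBinaryBiproducts A]

/-- The part of admissibility of `K : Wedge ⥤ A` that only involves middle indices `j < 0`,
together with the vanishing of the diagonal and the admissibility of the monomorphisms
`K_{i,j} ⟶ K_{i,k}` for all `j`. -/
structure IsAdmBelowZero (𝓔 : ExactStructure A) (K : Wedge ⥤ A) : Prop where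
  isZero_diag : ∀ j : ℤ, IsZero (K.obj (Wedge.mk j j le_rfl))
  isAdmAt : ∀ {i j k : ℤ} (hij : i ≤ j) (hjk : j ≤ k), j < 0 → IsAdmAt 𝓔 K hij hjk
  admMono : ∀ {i j k : ℤ} (hij : i ≤ j) (hjk : j ≤ k),
    IsAdmMono 𝓔.E (K.map (Wedge.hom hij (hij.trans hjk) le_rfl hjk))

variable {𝓔 : ExactStructure A} {K : Wedge ⥤ A}

theorem IsAdmBelowZero.hasCokernel (hK : IsAdmBelowZero 𝓔 K) (p : Wedge) :
    HasCokernel ((lowUp K).app p) :=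
  (hK.admMono (min_le_left _ _) p.property).hasCokernel

theorem IsAdmBelowZero.isCocartesianAt (hK : IsAdmBelowZero 𝓔 K) {i j k l : ℤ} (hij : i ≤ j)
    (hjk : j ≤ k) (hkl : k ≤ l) (hj : j < 0) : IsCocartesianAt K hij hjk hkl :=
  (hK.isAdmAt hij hjk hj).isCocartesianAt (hK.isZero_diag j) (hK.isAdmAt hij (hjk.trans hkl) hj)

variable [∀ p, HasCokernel ((lowUp K).app p)]

theorem IsAdmBelowZero.isCocartesianAt_coker (hK : IsAdmBelowZero 𝓔 K) {i j k : ℤ} (hij : i ≤ j)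
    (hjk : j ≤ k) : IsCocartesianAt (cokerFunctor (lowUp K)) hij le_rfl hjk := by
  refine IsPushout.of_top (h₁₁ := (wedgeUp ⋙ K).map (Wedge.hom hij (hij.trans hjk) le_rfl hjk)) ?_
    (wedge_comp _ _ _ _ _) (isPushout_coker_lowUp K hij hjk)
  rw [← (cokerFunctorπ (lowUp K)).naturality, ← (cokerFunctorπ (lowUp K)).naturality]
  exact (hK.isCocartesianAt (min_le_min_right (-1) hij) (min_le_left j (-1)) hjk
    (min_lt_of_right_lt neg_one_lt_zero)).paste_vert (isPushout_coker_lowUp K le_rfl hjk)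

theorem IsAdmBelowZero.isAdm_coker (hK : IsAdmBelowZero 𝓔 K) :
    isAdm 𝓔 (cokerFunctor (lowUp K)) := fun _ j _ hij hjk =>
  IsAdmAt.of_isCocartesianAt (isZero_coker_lowUp K j)
    ((hK.admMono (min_le_of_left_le hij) hjk).of_isPushout (isPushout_coker_lowUp K hij hjk))
    (hK.isCocartesianAt_coker hij hjk)

theorem IsAdmBelowZero.isIso_cokerFunctorπ_app (hK : IsAdmBelowZero 𝓔 K) {p : Wedge}
    (hp : p.1.1 < 0) : IsIso ((cokerFunctorπ (lowUp K)).app p) := by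
  have hlow : wedgeLow.obj p = Wedge.mk p.1.1 p.1.1 le_rfl :=
    Subtype.ext (Prod.ext (min_eq_left (Int.le_sub_one_of_lt hp)) rfl)
  apply LocCompact.isIso_cokerFunctorπ_app
  rw [Functor.comp_obj, hlow]
  exact hK.isZero_diag _

end WedgeExt

section Quadrant

variable {A : Type u} [Category.{v} A]

theorem negSucc_le_negSucc_iff {m n : ℕ} : Int.negSucc m ≤ Int.negSucc n ↔ n ≤ m := by
  omega

/-- The embedding `(j, n) ↦ (-n - 1, j)` of the quadrant `i < 0 ≤ j` into `Wedge`. -/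
def quadrant : ℕ × ℕᵒᵖ ⥤ Wedge where
  obj p := Wedge.mk (Int.negSucc p.2.unop) p.1 (by omega)
  map f := Wedge.hom _ _ (negSucc_le_negSucc_iff.2 f.2.unop.le) (Int.ofNat_le.2 f.1.le)
  map_id _ := Subsingleton.elim _ _
  map_comp _ _ := Subsingleton.elim _ _

/-- The restriction of functors on `Wedge` to the quadrant `i < 0 ≤ j`, in curried form. -/
def quadrantRestrict : (Wedge ⥤ A) ⥤ (ℕ ⥤ ℕᵒᵖ ⥤ A) :=
  (Functor.whiskeringLeft _ _ _).obj quadrant ⋙ Functor.curry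

theorem isIso_quadrantRestrict_map {X Y : Wedge ⥤ A} (α : X ⟶ Y)
    (hα : ∀ p : Wedge, p.1.1 < 0 → 0 ≤ p.1.2 → IsIso (α.app p)) :
    IsIso (quadrantRestrict.map α) := by
  have (p : ℕ × ℕᵒᵖ) : IsIso ((Functor.whiskerLeft quadrant α).app p) :=
    hα _ (Int.negSucc_lt_zero _) (Int.natCast_nonneg _)
  have : IsIso (Functor.whiskerLeft quadrant α) := NatIso.isIso_of_isIso_app _
  exact Functor.map_isIso Functor.curry (Functor.whiskerLeft quadrant α)

theorem nonempty_wedgeLim_iso_quadrantRestrict (X : Wedge ⥤ A) :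
    Nonempty (wedgeLim.obj X ≅ (indProLim ℕ ℕ).obj (quadrantRestrict.obj X)) := by
  have hF : Monotone (fun n : ℕ => (n : ℤ)) := fun _ _ h => Int.ofNat_le.2 h
  have hG : Monotone (fun n : ℕ => OrderDual.toDual (Int.negSucc n)) := fun _ _ h =>
    OrderDual.toDual_le_toDual.2 (negSucc_le_negSucc_iff.2 h)
  have : hF.functor.Final := by
    rw [Monotone.final_functor_iff]
    exact fun n => ⟨n.toNat, Int.self_le_toNat n⟩
  have : hG.functor.Final := by
    rw [Monotone.final_functor_iff]
    exact fun n => ⟨(-(OrderDual.ofDual n)).toNat,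
      show Int.negSucc (-(OrderDual.ofDual n)).toNat ≤ OrderDual.ofDual n by omega⟩
  obtain ⟨e⟩ := indProLim_restrict hG.functor hF.functor (extend.obj X)
  have hmin (j n : ℕ) : min (Int.negSucc n) (j : ℤ) = Int.negSucc n := by omega
  exact ⟨e ≪≫ (indProLim ℕ ℕ).mapIso (NatIso.ofComponents
    (fun j => NatIso.ofComponents
      (fun n => X.mapIso (eqToIso (Subtype.ext (Prod.ext (hmin j n.unop) rfl))))
      fun _ => wedge_comp X _ _ _ _)
    fun _ => NatTrans.ext (funext fun _ => wedge_comp X _ _ _ _))⟩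

end Quadrant

section ZeroExt

open scoped ZeroObject

section

variable {B : Type*} [Category* B] [HasZeroObject B]

theorem not_ofNat_le_negSucc (m n : ℕ) : ¬ Int.ofNat m ≤ Int.negSucc n :=
  not_le.2 ((Int.negSucc_lt_zero n).trans_le (Int.natCast_nonneg m))

/-- The values of `zeroExt`. -/
def zeroExtObj (G : ℕᵒᵖ ⥤ B) : ℤ → B
  | .ofNat _ => 0
  | .negSucc n => G.obj (op n)

/-- The maps of `zeroExt`. -/
def zeroExtMap (G : ℕᵒᵖ ⥤ B) : ∀ i i' : ℤ, i ≤ i' → (zeroExtObj G i ⟶ zeroExtObj G i')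
  | .negSucc _, .negSucc _, h => G.map (homOfLE (negSucc_le_negSucc_iff.1 h)).op
  | .negSucc _, .ofNat _, _ => (isZero_zero B).from_ _
  | .ofNat _, _, _ => (isZero_zero B).to_ _

/-- The extension of a functor on `ℕᵒᵖ` by zero to the integers, with `-n - 1` in place of `n`. -/
def zeroExt (G : ℕᵒᵖ ⥤ B) : ℤ ⥤ B where
  obj := zeroExtObj G
  map {i i'} f := zeroExtMap G i i' f.le
  map_id i := by
    cases i with
    | ofNat n => exact (isZero_zero B).eq_of_src _ _
    | negSucc n => exact G.map_id _
  map_comp {i i' i''} f g := by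
    rcases i with m | m <;> rcases i' with n | n <;> rcases i'' with l | l
    case negSucc.negSucc.negSucc => exact G.map_comp _ _
    case negSucc.ofNat.negSucc => exact (not_ofNat_le_negSucc _ _ g.le).elim
    case negSucc.negSucc.ofNat | negSucc.ofNat.ofNat => exact (isZero_zero B).eq_of_tgt _ _
    all_goals exact (isZero_zero B).eq_of_src _ _

theorem isZero_zeroExt_obj (G : ℕᵒᵖ ⥤ B) {i : ℤ} (hi : 0 ≤ i) : IsZero ((zeroExt G).obj i) := by
  cases i with
  | ofNat n => exact isZero_zero B
  | negSucc n => exact absurd hi (Int.negSucc_not_nonneg n).1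

end

section

variable {A : Type u} [Category.{v} A]

/-- The functor `(i, j) ↦ (i, max j 0)` from `Wedge`. -/
def wedgeToProd : Wedge ⥤ ℤ × ℕ where
  obj p := (p.1.1, p.1.2.toNat)
  map f := (homOfLE f.le.1, homOfLE (Int.toNat_le_toNat f.le.2))
  map_id _ := rfl
  map_comp _ _ := rfl

variable [HasZeroObject A]

/-- The functor on `Wedge` with values `X_{-i-1,max(j,0)}` for `i < 0` and zero for `0 ≤ i`. -/
def zeroContinuation (X : ℕ ⥤ ℕᵒᵖ ⥤ A) : Wedge ⥤ A :=
  wedgeToProd ⋙ Functor.uncurry.obj (zeroExt X.flip)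

theorem zeroContinuation_map_left (X : ℕ ⥤ ℕᵒᵖ ⥤ A) {i i' j : ℤ} (hi : i ≤ i') (hij : i' ≤ j) :
    (zeroContinuation X).map (Wedge.hom (hi.trans hij) hij hi le_rfl) =
      ((zeroExt X.flip).map (homOfLE hi)).app j.toNat :=
  (congrArg _ (((zeroExt X.flip).obj i').map_id _)).trans (Category.comp_id _)

theorem zeroContinuation_map_right (X : ℕ ⥤ ℕᵒᵖ ⥤ A) {i j j' : ℤ} (hij : i ≤ j) (hj : j ≤ j') :
    (zeroContinuation X).map (Wedge.hom hij (hij.trans hj) le_rfl hj) =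
      ((zeroExt X.flip).obj i).map (homOfLE (Int.toNat_le_toNat hj)) :=
  (congrArg (· ≫ _) (NatTrans.congr_app ((zeroExt X.flip).map_id i) _)).trans (Category.id_comp _)

variable [Preadditive A] [HasBinaryBiproducts A] {𝓔 : ExactStructure A}

theorem isZeroContinuation_zeroContinuation {X : ℕ ⥤ ℕᵒᵖ ⥤ A} (hX : IsAdmBifunctor 𝓔 X)
    (hX' : HasCartesianSquares X) : IsZeroContinuation 𝓔 (zeroContinuation X) where
  isZero _ hi := (isZero_zeroExt_obj X.flip hi).obj _
  admEpi {i i' j} hi hij := by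
    rw [zeroContinuation_map_left]
    obtain hi' | hi' := le_or_gt 0 i'
    · exact isAdmEpi_of_isZero 𝓔 ((isZero_zeroExt_obj X.flip hi').obj _) _
    · obtain ⟨n, rfl⟩ := Int.eq_negSucc_of_lt_zero hi'
      obtain ⟨m, rfl⟩ := Int.eq_negSucc_of_lt_zero (hi.trans_lt hi')
      exact hX.admEpi j.toNat (homOfLE (negSucc_le_negSucc_iff.1 hi))
  admMono {i j j'} hij hj := by
    rw [zeroContinuation_map_right]
    obtain hi | hi := le_or_gt 0 i
    · exact isAdmMono_of_isZero 𝓔 ((isZero_zeroExt_obj X.flip hi).obj _) _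
    · obtain ⟨n, rfl⟩ := Int.eq_negSucc_of_lt_zero hi
      exact hX.admMono n (homOfLE (Int.toNat_le_toNat hj))
  isPullback {i i' j j'} hi hij hj hi' := by
    obtain ⟨n, rfl⟩ := Int.eq_negSucc_of_lt_zero hi'
    obtain ⟨m, rfl⟩ := Int.eq_negSucc_of_lt_zero (hi.trans_lt hi')
    rw [zeroContinuation_map_left, zeroContinuation_map_left, zeroContinuation_map_right,
      zeroContinuation_map_right]
    exact hX' (homOfLE (negSucc_le_negSucc_iff.1 hi)) (homOfLE (Int.toNat_le_toNat hj))

/-- The restriction of `zeroContinuation X` to the quadrant `i < 0 ≤ j` is `X`. -/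
def quadrantRestrictZeroContinuation (X : ℕ ⥤ ℕᵒᵖ ⥤ A) :
    quadrantRestrict.obj (zeroContinuation X) ≅ X :=
  NatIso.ofComponents
    (fun j => NatIso.ofComponents (fun n => Iso.refl ((X.obj j).obj n)) fun {_ _} f =>
      (Category.comp_id _).trans ((zeroContinuation_map_left X
        (negSucc_le_negSucc_iff.2 f.unop.le) (Int.negSucc_lt_zero _ |>.le.trans
          (Int.natCast_nonneg j))).trans (Category.id_comp _).symm))
    fun {_ _} g => NatTrans.ext (funext fun n =>
      (Category.comp_id _).trans ((zeroContinuation_map_right X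
        (Int.negSucc_lt_zero n.unop |>.le.trans (Int.natCast_nonneg _))
        (Int.ofNat_le.2 g.le)).trans (Category.id_comp _).symm))

end

end ZeroExt

section EssSurj

variable {A : Type u} [Category.{v} A] [Preadditive A] [HasZeroObject A] [HasBinaryBiproducts A]
  {𝓔 : ExactStructure A}

theorem IsZeroContinuation.isAdmBelowZero_ker {V : Wedge ⥤ A} (hV : IsZeroContinuation 𝓔 V)
    [∀ p, HasKernel ((diagHom V).app p)] : IsAdmBelowZero 𝓔 (kerFunctor (diagHom V)) where
  isZero_diag := isZero_ker_diagHom V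
  isAdmAt := hV.isAdmAt_ker
  admMono := hV.admMono_ker

theorem IsZeroContinuation.exists_isAdm {V : Wedge ⥤ A} (hV : IsZeroContinuation 𝓔 V) :
    ∃ W : Wedge ⥤ A, isAdm 𝓔 W ∧ Nonempty (quadrantRestrict.obj W ≅ quadrantRestrict.obj V) := by
  have := hV.hasKernel
  have hK := hV.isAdmBelowZero_ker
  have := hK.hasCokernel
  have := isIso_quadrantRestrict_map (kerFunctorι (diagHom V))
    fun p _ hp => hV.isIso_kerFunctorι_app p hp
  have := isIso_quadrantRestrict_map (upHom (kerFunctor (diagHom V)))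
    fun p hp _ => isIso_upHom_app _ hp
  have := isIso_quadrantRestrict_map (cokerFunctorπ (lowUp (kerFunctor (diagHom V))))
    fun p hp _ => hK.isIso_cokerFunctorπ_app hp
  exact ⟨_, hK.isAdm_coker,
    ⟨(asIso (quadrantRestrict.map (cokerFunctorπ (lowUp (kerFunctor (diagHom V)))))).symm ≪≫
      asIso (quadrantRestrict.map (upHom (kerFunctor (diagHom V)))) ≪≫
      asIso (quadrantRestrict.map (kerFunctorι (diagHom V)))⟩⟩

theorem exists_isAdm_wedgeLim_iso {X : ℕ ⥤ ℕᵒᵖ ⥤ A} (hX : IsAdmBifunctor 𝓔 X)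
    (hX' : HasCartesianSquares X) :
    ∃ W : Wedge ⥤ A, isAdm 𝓔 W ∧ Nonempty (wedgeLim.obj W ≅ (indProLim ℕ ℕ).obj X) := by
  obtain ⟨W, hW, ⟨e⟩⟩ := (isZeroContinuation_zeroContinuation hX hX').exists_isAdm
  obtain ⟨e'⟩ := nonempty_wedgeLim_iso_quadrantRestrict W
  exact ⟨W, hW, ⟨e' ≪≫ (indProLim ℕ ℕ).mapIso (e ≪≫ quadrantRestrictZeroContinuation X)⟩⟩

theorem IsAdmBifunctor.restrict {I J I' J' : Type} [SmallCategory I] [SmallCategory J]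
    [SmallCategory I'] [SmallCategory J'] {X : J ⥤ Iᵒᵖ ⥤ A} (hX : IsAdmBifunctor 𝓔 X)
    (G : I' ⥤ I) (F : J' ⥤ J) : IsAdmBifunctor 𝓔 (restrict G F X) where
  admEpi j _ _ f := hX.admEpi (F.obj j) (G.map f)
  admMono i _ _ g := hX.admMono (G.obj i) (F.map g)

instance : (embedding 𝓔).EssSurj where
  mem_essImage P := by
    obtain ⟨I, J, _, _, _, _, _, _, X, hX, hX', ⟨e⟩⟩ := P.property
    obtain ⟨eℕ⟩ := indProLim_restrict (IsFiltered.sequentialFunctor I)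
      (IsFiltered.sequentialFunctor J) X
    obtain ⟨W, hW, ⟨eW⟩⟩ := exists_isAdm_wedgeLim_iso (hX.restrict (IsFiltered.sequentialFunctor I)
      (IsFiltered.sequentialFunctor J)) (fun _ _ _ _ => hX' _ _)
    exact ⟨(Ua 𝓔).Q.obj ⟨W, hW⟩, ⟨ObjectProperty.isoMk _ (ObjectProperty.isoMk _
      (eW ≪≫ eℕ.symm ≪≫ e.symm))⟩⟩

end EssSurj

end LocCompact

end

/-- For an exact category `A`, the functor from the Beilinson category to the admissible Kato
category induced by `X ↦ "colim"_j "lim"_i X_{i,j}` is an equivalence of categories. -/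
theorem mainTheorem2 {A : Type u} [Category.{v} A] [Preadditive A] [HasZeroObject A]
    [HasBinaryBiproducts A] (𝓔 : LocCompact.ExactStructure A) :
    (LocCompact.embedding 𝓔).IsEquivalence := by
  have full : (LocCompact.embedding 𝓔).Full := inferInstance
  have faithful : (LocCompact.embedding 𝓔).Faithful := inferInstance
  have essSurj : (LocCompact.embedding 𝓔).EssSurj := inferInstance
  exact { }
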